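/- **Setting.** Let $d,T\ge 1$, $G,\epsilon,\varrho>0$. In round $t=1,\dots,T$ an adversary chooses $\ell_t\in\mathbb R^d$ with $\|\ell_t\|\le G$ (Euclidean norm) depending on the history $\mathcal F_{t-1}$, and the learner plays $\widetilde w_t\in\mathbb R^d$ and observes only $\langle\ell_t,\widetilde w_t\rangle$. Here $(\mathcal F_t)$ is a filtration such that $\ell_t$ is $\mathcal F_{t-1}$-measurable, and the learner's random direction $s_t$ of round $t$ (see below) is $\mathcal F_t$-measurable and independent of $\mathcal F_{t-1}$. For random vectors $u_1,\dots,u_T$ in $\mathbb R^d$ put $R_T(u_{1:T})=\sum_{t=1}^T\langle \ell_t,\widetilde w_t-u_t\rangle$. **PABLO.** Given an OLO learner $\mathcal A$ with current iterate $w_t$, put $H_t=\frac{1}{d(\|w_t\|^2\vee\varrho^2)}I_d$, let $v_1,\dots,v_d$ be an orthonormal basis (of eigenvectors of $H_t$), draw $s_t$ uniformly from $\{\pm v_i\}$, play $\widetilde w_t=w_t+H_t^{-1/2}s_t$, and send $\widetilde\ell_t=d\,H_t^{1/2}s_t\langle\ell_t,\widetilde w_t\rangle$ to $\mathcal A$.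 **Refined dynamic OLO algorithm** with Lipschitz constant $L$ and parameter $\epsilon'$. For every $\eta\in\mathcal S=\{\frac{2^i}{TL}\wedge\frac1L: i=0,1,\dots\}$ run the base algorithm with $w_1^\eta=0$, $\alpha=\epsilon'/T$, $\gamma=L/T$, $k=4$, which on receiving $g_t$ sets $$\theta_t=\tfrac{k}{\eta}\log\!\big(\tfrac{\|w_t^\eta\|}{\alpha}+1\big)\tfrac{w_t^\eta}{\|w_t^\eta\|}-g_t,\qquad w_{t+1}^\eta=\tfrac{\theta_t}{\|\theta_t\|}\,\alpha\Big[\exp\!\big(\tfrac{\eta}{k}\big(\|\theta_t\|-\tfrac{\eta}{2}\|g_t\|^2-\gamma\big)\big)-1\Big]_+$$ (with $0/\|0\|=0$), and play $w_t=\sum_{\eta\in\mathcal S}w_t^\eta$. **Theorem.** There is an absolute constant $C>0$ such that the following holds for all $d,T,G,\epsilon,\varrho$ and all adversaries as above, when PABLO uses the refined dynamic OLO algorithm with $L=3dG$ (a bound on the norms of $\widetilde\ell_t$ and of $\ell_t-\widetilde\ell_t$) and $\epsilon'=\epsilon/d$. Let $$\Phi_T=\|u_T\|\log\!\big(\tfrac{\|u_T\|T}{\epsilon}+1\big),\qquad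 P_T^\Phi=\sum_{t=2}^T\|u_t-u_{t-1}\|\log\!\big(\tfrac{\|u_t-u_{t-1}\|T^3}{\epsilon}+1\big).$$ Then for every comparator sequence $u_{1:T}$ of random vectors $$\mathbb E[R_T(u_{1:T})]\le C\,\mathbb E\Big[\tfrac{d}{\kappa}\sqrt{(\Phi_T+P_T^\Phi)\textstyle\sum_{t=1}^T q_t\|u_t\|}+dG\big(\epsilon+\max_t\|u_t\|+\Phi_T+P_T^\Phi\big)\Big]$$ whenever the right-hand side is finite (in which case $R_T(u_{1:T})$ is integrable), in each of the following cases: 1. (adaptive) $\ell_t$ and $u_{1:T}$ are arbitrary as above (the $u_t$ may depend on everything), with $\kappa=1$, $q_t=\|\ell_t\|^2$; 2. (partially oblivious) $u_{1:T}$ is $\mathcal F_0$-measurable, with $\kappa=\sqrt d$, $q_t=\mathbb E[\|\ell_t\|^2\mid\mathcal F_0]$; 3. (oblivious) $u_{1:T}$ and $\ell_{1:T}$ are $\mathcal F_0$-measurable (for instance deterministic), with $\kappa=\sqrt d$, $q_t=\|\ell_t\|^2$. In particular the algorithm depends only on $d,T,G,\epsilon,\varrho$, and not on the path length of the comparators.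 -/

import Mathlib

open MeasureTheory ProbabilityTheory
open scoped BigOperators

noncomputable section

/-- A deterministic online linear optimization (OLO) learner on `E`: it maps the list of loss
vectors received so far (most recent first) to the next decision. -/
abbrev OLOLearner (E : Type*) := List E → E

section Learners

variable {E : Type*} [NormedAddCommGroup E] [InnerProductSpace ℝ E]

/-- One update `w_t ↦ w_{t+1}` of the refined dynamic base algorithm, unconstrained and with
initial point `0`, on the loss vector `g = g_t`:
`θ_t = (k/η) log(‖w_t‖/α + 1) w_t/‖w_t‖ - g_t` and
`w_{t+1} = α [exp((η/k)(‖θ_t‖ - (η/2)‖g_t‖² - γ)) - 1]_+ θ_t/‖θ_t‖`, with `0/‖0‖ = 0`. -/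
def baseStep (k α γ η : ℝ) (g w : E) : E :=
  let θ : E := (k / η * Real.log (‖w‖ / α + 1)) • (‖w‖⁻¹ • w) - g
  (α * max (Real.exp (η / k * (‖θ‖ - η / 2 * ‖g‖ ^ 2 - γ)) - 1) 0) • (‖θ‖⁻¹ • θ)

/-- The refined dynamic base algorithm for OLO, unconstrained and started at `0`. -/
def dynamicBaseOLO (k α γ η : ℝ) : OLOLearner E
  | [] => 0
  | g :: hist => baseStep k α γ η g (dynamicBaseOLO k α γ η hist)

/-- The finite set of step sizes `{2^i/(TL) ∧ 1/L : i = 0, 1, …}` (see `coe_stepSizes`). -/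
def stepSizes (T : ℕ) (L : ℝ) : Finset ℝ :=
  (Finset.range (T + 1)).image fun i : ℕ => min ((2 : ℝ) ^ i / (T * L)) (1 / L)

/-- The refined dynamic (meta) algorithm for OLO with horizon `T`, Lipschitz constant `L` and
parameter `ε`: it plays the sum over the step sizes `η` of the iterates of the base algorithms with
`α = ε/T`, `γ = L/T`, `k = 4`, all fed with the same loss vectors. -/
def dynamicMetaOLO (T : ℕ) (L ε : ℝ) : OLOLearner E := fun hist =>
  ∑ η ∈ stepSizes T L, dynamicBaseOLO 4 (ε / T) (L / T) η hist

end Learners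

theorem coe_stepSizes (T : ℕ) (hT : 1 ≤ T) (L : ℝ) (hL : 0 < L) :
    (stepSizes T L : Set ℝ) =
      Set.range fun i : ℕ => min ((2 : ℝ) ^ i / (T * L)) (1 / L) := by
  have key : ∀ i : ℕ, T ≤ i → min ((2 : ℝ) ^ i / (T * L)) (1 / L) = 1 / L := by
    intro i hi
    have hT0 : (0 : ℝ) < T := by exact_mod_cast hT
    have h1 : (T : ℝ) ≤ 2 ^ i := by
      have h2 : T < 2 ^ T := Nat.lt_two_pow_self
      have h3 : 2 ^ T ≤ 2 ^ i := Nat.pow_le_pow_right (by norm_num) hi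
      exact_mod_cast (h2.le.trans h3)
    apply min_eq_right
    rw [div_le_div_iff₀ hL (by positivity)]
    nlinarith
  ext x
  simp only [stepSizes, Finset.coe_image, Finset.coe_range, Set.mem_image, Set.mem_Iio,
    Set.mem_range]
  constructor
  · rintro ⟨i, -, rfl⟩
    exact ⟨i, rfl⟩
  · rintro ⟨i, rfl⟩
    by_cases hi : i < T + 1
    · exact ⟨i, hi, rfl⟩
    · exact ⟨T, Nat.lt_succ_self T, by rw [key T le_rfl, key i (by omega)]⟩

section PABLO

variable {d : ℕ}

/-- The factor `h` of the isotropic perturbation matrix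
`H_t = h I_d`, `h = 1 / (d (‖w_t‖² ∨ ϱ²))`; hence `H_t^{±1/2}` acts as multiplication by
`(√h)^{±1}`, and every orthonormal basis is a basis of eigenvectors of `H_t`. -/
def perturbScale (ϱ : ℝ) (w : EuclideanSpace ℝ (Fin d)) : ℝ :=
  1 / (d * max (‖w‖ ^ 2) (ϱ ^ 2))

/-- The action `w_t + H_t^{-1/2} s_t`. -/
def perturbedAction (ϱ : ℝ) (w s : EuclideanSpace ℝ (Fin d)) : EuclideanSpace ℝ (Fin d) :=
  w + (√(perturbScale ϱ w))⁻¹ • s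

/-- The loss estimate `d H_t^{1/2} s_t y_t`, where `y_t` is the observed scalar feedback. -/
def lossEstimate (ϱ : ℝ) (w s : EuclideanSpace ℝ (Fin d)) (y : ℝ) : EuclideanSpace ℝ (Fin d) :=
  ((d : ℝ) * y * √(perturbScale ϱ w)) • s

/-- The loss estimates (most recent first) that PABLO has sent to its OLO learner `A` before
round `t` (rounds are numbered from `0`), when the losses are `ℓ` and the sampled directions are
`s`. -/
def pabloHistory (A : OLOLearner (EuclideanSpace ℝ (Fin d))) (ϱ : ℝ)
    (ℓ s : ℕ → EuclideanSpace ℝ (Fin d)) : ℕ → List (EuclideanSpace ℝ (Fin d))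
  | 0 => []
  | t + 1 =>
    let hist := pabloHistory A ϱ ℓ s t
    let w := A hist
    lossEstimate ϱ w (s t) (inner ℝ (ℓ t) (perturbedAction ϱ w (s t))) :: hist

/-- The action played by PABLO in round `t`. -/
def pabloAction (A : OLOLearner (EuclideanSpace ℝ (Fin d))) (ϱ : ℝ)
    (ℓ s : ℕ → EuclideanSpace ℝ (Fin d)) (t : ℕ) : EuclideanSpace ℝ (Fin d) :=
  perturbedAction ϱ (A (pabloHistory A ϱ ℓ s t)) (s t)

/-- The dynamic regret `∑_t ⟨ℓ_t, x_t - u_t⟩` of the actions of PABLO over `T` rounds. -/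
def pabloRegret (A : OLOLearner (EuclideanSpace ℝ (Fin d))) (ϱ : ℝ) (T : ℕ)
    (ℓ s u : ℕ → EuclideanSpace ℝ (Fin d)) : ℝ :=
  ∑ t ∈ Finset.range T, inner ℝ (ℓ t) (pabloAction A ϱ ℓ s t - u t)

/-- The set `{± v_i : i}` of directions from which PABLO samples. -/
def signedBasis (v : OrthonormalBasis (Fin d) ℝ (EuclideanSpace ℝ (Fin d))) :
    Set (EuclideanSpace ℝ (Fin d)) :=
  {x | ∃ i, x = v i ∨ x = -v i}

/-- `Φ_T = ‖u_T‖ log(‖u_T‖ T / ε + 1)`; as rounds are numbered from `0`, the last comparator is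
`u (T - 1)`. -/
def phiLast (T : ℕ) (ε : ℝ) (u : ℕ → EuclideanSpace ℝ (Fin d)) : ℝ :=
  ‖u (T - 1)‖ * Real.log (‖u (T - 1)‖ * T / ε + 1)

/-- The linearithmic path length
`P_T^Φ = ∑_{t=2}^T ‖u_t - u_{t-1}‖ log(‖u_t - u_{t-1}‖ T³ / ε + 1)`. -/
def phiPathLength (T : ℕ) (ε : ℝ) (u : ℕ → EuclideanSpace ℝ (Fin d)) : ℝ :=
  ∑ t ∈ Finset.range (T - 1),
    ‖u (t + 1) - u t‖ * Real.log (‖u (t + 1) - u t‖ * (T : ℝ) ^ 3 / ε + 1)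

/-- `(d/κ) √((Φ_T + P_T^Φ) ∑_t q_t ‖u_t‖) + d G (ε + max_t ‖u_t‖ + Φ_T + P_T^Φ)`. -/
def dynamicBound (κ : ℝ) (T : ℕ) (G ε : ℝ) (q : ℕ → ℝ) (u : ℕ → EuclideanSpace ℝ (Fin d)) : ℝ :=
  d / κ * √((phiLast T ε u + phiPathLength T ε u) * ∑ t ∈ Finset.range T, q t * ‖u t‖)
    + d * G * (ε + (⨆ t : Fin T, ‖u t‖) + phiLast T ε u + phiPathLength T ε u)

end PABLO

end

/-!
The proof has a deterministic part, on online linear optimization, and a probabilistic part, on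
the loss estimates.

*The base algorithm.* One update is a mirror descent step with a composite penalty. In the dual
space it reads `p_{t+1} = p_t - g_t - z_t`, where `p_t` is the dual point of the iterate `w_t` and
`z_t` is a subgradient of `(η/2 ‖g_t‖² + γ) ‖·‖` at `w_{t+1}`. The conjugate of the regularizer is
the explicit radial function `α (k/η) (exp (η r / k) - η r / k - 1)`, so its smoothness can be
checked by hand (`exp_norm_sub_le`), and the penalty pays for the second-order term
(`inner_add_dualPotential_baseStep_le`). Summation by parts against the comparators, the
Fenchel-Young inequality for the last one, and the remaining `-γ ‖w_t‖`, which turns the logarithm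
of the iterate into a logarithm of the comparator increment (`mul_log_sub_le`), give
`base_regret_le`.

*All step sizes.* The base algorithms that are not tuned to the comparator are compared with `0`,
which costs `O(η L² ε)` each; the step sizes being geometric, this adds up to `O(L ε)`. Tuning over
the grid gives `metaOLO_regret_le`.

*The logarithms.* The algorithm is run with `ε / d`, hence a factor `d` appears inside the
logarithms. It is removed by `comparatorCost_div_le` when `d ≤ T` and the largest comparator norm
`M` is at least of order `d ε / T`: either the last comparator has norm of order `M`, and then its
logarithm already dominates `log d`, or the comparators have travelled a distance of order `M`,
and the path length pays. The remaining comparators are negligible (`IsNegligible`): their total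
loss is of the order of the additive terms, and they are replaced by `0`.

*The loss estimates.* With the perturbation matrix `h I`, the estimate is unbiased, bounded by
`2 d ‖ℓ‖`, and has second moment at most `2 d ‖ℓ‖²`. Adaptive comparators
(`IsBanditProcess.adaptive_regret_le`) correlate with the estimation errors; this is handled
pathwise by a second, virtual learner that is run on those errors and whose own decisions are
predictable. For comparators fixed at the start (`IsBanditProcess.oblivious_regret_le`) the errors
have mean zero, and the square root is linearized around a quantity known at the start
(`sqrt_mul_le_half_add`), so that only the second moments enter.
-/

/-! ### Elementary inequalities for the exponential and the logarithm -/

theorem exp_neg_le_quadratic {x : ℝ} (hx : 0 ≤ x) : Real.exp (-x) ≤ 1 - x + x ^ 2 / 2 := by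
  have h1 := Real.quadratic_le_exp_of_nonneg hx
  have h2 : 0 < 1 + x + x ^ 2 / 2 := by positivity
  rw [Real.exp_neg]
  have h3 : (Real.exp x)⁻¹ ≤ (1 + x + x ^ 2 / 2)⁻¹ := inv_anti₀ h2 h1
  refine h3.trans ?_
  rw [inv_le_iff_one_le_mul₀ h2]
  nlinarith [sq_nonneg (x ^ 2)]

theorem exp_sub_sub_one_sub_le {b c : ℝ} (hc : 0 ≤ c) (hcb : c ≤ b) :
    (Real.exp b - b - 1) - (Real.exp c - c - 1) ≤ Real.exp b * (b ^ 2 - c ^ 2) / 2 := by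
  have hmono : MonotoneOn (fun r : ℝ => Real.exp b * r ^ 2 / 2 - (Real.exp r - r - 1))
      (Set.Icc 0 b) := by
    have hd : ∀ r : ℝ, HasDerivAt (fun r : ℝ => Real.exp b * r ^ 2 / 2 - (Real.exp r - r - 1))
        (Real.exp b * r - (Real.exp r - 1)) r := by
      intro r
      have h1 : HasDerivAt (fun r : ℝ => Real.exp b * r ^ 2 / 2) (Real.exp b * r) r := by
        refine (((hasDerivAt_pow 2 r).const_mul (Real.exp b)).div_const 2).congr_deriv ?_
        norm_num
        ring
      exact h1.sub (((Real.hasDerivAt_exp r).sub (hasDerivAt_id r)).sub_const 1)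
    refine monotoneOn_of_deriv_nonneg (convex_Icc 0 b)
      (fun r _ => (hd r).continuousAt.continuousWithinAt)
      (fun r _ => (hd r).differentiableAt.differentiableWithinAt) ?_
    intro r hr
    rw [interior_Icc] at hr
    rw [(hd r).deriv]
    have h1 : 1 - r ≤ Real.exp (-r) := by linarith [Real.add_one_le_exp (-r)]
    have h2 : Real.exp r * Real.exp (-r) = 1 := by rw [← Real.exp_add]; simp
    have h3 : Real.exp r ≤ Real.exp b := Real.exp_le_exp.2 hr.2.le
    nlinarith [hr.1, Real.exp_pos r, mul_le_mul_of_nonneg_left h1 (Real.exp_pos r).le,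
      mul_le_mul_of_nonneg_right h3 hr.1.le]
  have := hmono ⟨hc, hcb⟩ ⟨hc.trans hcb, le_rfl⟩ hcb
  simp only at this
  linarith

/-- Second-order upper bound along the line through the origin for the even function
`r ↦ exp |r| - |r| - 1`. -/
theorem exp_abs_sub_le {a x : ℝ} (ha : 0 ≤ a) :
    Real.exp |a - x| - |a - x| - 1 ≤
      (Real.exp a - a - 1) - (Real.exp a - 1) * x + Real.exp (a + |x|) * x ^ 2 / 2 := by
  rcases le_total x a with hxa | hax
  · rw [abs_of_nonneg (by linarith)]
    have h1 : Real.exp (-x) ≤ 1 - x + Real.exp |x| * x ^ 2 / 2 := by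
      rcases le_total 0 x with hx | hx
      · have h2 := exp_neg_le_quadratic hx
        have h3 : 1 ≤ Real.exp |x| := Real.one_le_exp (abs_nonneg x)
        nlinarith [sq_nonneg x]
      · have h2 := exp_sub_sub_one_sub_le (le_refl 0) (neg_nonneg.2 hx)
        rw [abs_of_nonpos hx]
        simp only [Real.exp_zero] at h2
        nlinarith
    have h4 := mul_le_mul_of_nonneg_left h1 (Real.exp_pos a).le
    rw [sub_eq_add_neg a x, Real.exp_add, Real.exp_add]
    nlinarith
  · -- the argument has changed sign: `x = a + n` with `n ≥ 0`
    obtain ⟨n, rfl⟩ : ∃ n, x = a + n := ⟨x - a, by ring⟩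
    have hn : 0 ≤ n := by linarith
    have hab : |a - (a + n)| = n := by
      rw [show a - (a + n) = -n by ring, abs_neg, abs_of_nonneg hn]
    rw [hab, abs_of_nonneg (by linarith : 0 ≤ a + n)]
    have h1 := exp_sub_sub_one_sub_le (le_refl 0) hn
    simp only [Real.exp_zero] at h1
    have h2 := exp_neg_le_quadratic ha
    have h3 : Real.exp a * Real.exp (-a) = 1 := by rw [← Real.exp_add]; simp
    have h4 := mul_le_mul_of_nonneg_left h2 (Real.exp_pos a).le
    have hea : 0 < Real.exp a := Real.exp_pos a
    have h5 : Real.exp a ≤ Real.exp (a + (a + n)) := Real.exp_le_exp.2 (by linarith)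
    have h6 : Real.exp n ≤ Real.exp (a + (a + n)) := Real.exp_le_exp.2 (by linarith)
    have h7 : Real.exp a - 1 ≤ a * Real.exp a := by
      nlinarith [Real.add_one_le_exp (-a)]
    have h8 := mul_le_mul_of_nonneg_right h7 hn
    have h9 := mul_le_mul_of_nonneg_right h5 (sq_nonneg a)
    have h10 := mul_le_mul_of_nonneg_right h6 (sq_nonneg n)
    have h11 := mul_le_mul_of_nonneg_right h5 (mul_nonneg ha hn)
    nlinarith

/-- Fenchel-Young inequality for `exp x - x - 1`, in the weaker form with
`y log (y + 1)` in place of the conjugate function. -/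
theorem mul_le_exp_add_mul_log {x y : ℝ} (hy : 0 ≤ y) :
    x * y ≤ (Real.exp x - x - 1) + y * Real.log (y + 1) := by
  have hy1 : 0 < y + 1 := by linarith
  have h1 : x - Real.log (y + 1) + 1 ≤ Real.exp (x - Real.log (y + 1)) := Real.add_one_le_exp _
  rw [Real.exp_sub, Real.exp_log hy1, le_div_iff₀ hy1] at h1
  have h2 := Real.log_le_sub_one_of_pos hy1
  nlinarith

/-- The maximum over `x` of `a log (x / α + 1) - γ x` is at most `a log (a / (γ α) + 1)`. -/
theorem mul_log_sub_le {a x α γ : ℝ} (ha : 0 ≤ a) (hx : 0 ≤ x) (hα : 0 < α) (hγ : 0 < γ) :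
    a * Real.log (x / α + 1) - γ * x ≤ a * Real.log (a / (γ * α) + 1) := by
  have h1 : 0 < x / α + 1 := by positivity
  have h2 : 0 < a / (γ * α) + 1 := by positivity
  have h3 : Real.log ((x / α + 1) / (a / (γ * α) + 1)) ≤ (x / α + 1) / (a / (γ * α) + 1) - 1 :=
    Real.log_le_sub_one_of_pos (by positivity)
  rw [Real.log_div h1.ne' h2.ne'] at h3
  have h4 : a * ((x / α + 1) / (a / (γ * α) + 1) - 1) ≤ γ * x := by
    have : (x / α + 1) / (a / (γ * α) + 1) - 1 = (γ * x - a) / (a + γ * α) := by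
      field_simp
      ring
    rw [this, mul_div_assoc', div_le_iff₀ (by positivity)]
    nlinarith [mul_nonneg (mul_nonneg hγ.le hx) (mul_nonneg hγ.le hα.le), sq_nonneg a]
  nlinarith [mul_le_mul_of_nonneg_left h3 ha]

/-! ### The dual point and the potential of the base algorithm -/

section Base

variable {E : Type*} [NormedAddCommGroup E] [InnerProductSpace ℝ E]

/-- The gradient at `w` of the regularizer of the base algorithm, i.e. the point of the dual space
that corresponds to the iterate `w`. -/
noncomputable def mirrorDual (k α η : ℝ) (w : E) : E :=
  (k / η * Real.log (‖w‖ / α + 1)) • (‖w‖⁻¹ • w)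

/-- The radial profile of the convex conjugate of the regularizer of the base algorithm. -/
noncomputable def dualPotential (k α η r : ℝ) : ℝ :=
  α * (k / η) * (Real.exp (η / k * r) - η / k * r - 1)

theorem norm_smul_inv_norm_smul {x : E} {r : ℝ} (hr : 0 ≤ r) (h : x = 0 → r = 0) :
    ‖r • (‖x‖⁻¹ • x)‖ = r := by
  by_cases hx : x = 0
  · simp [hx, h hx]
  · rw [norm_smul, norm_smul, norm_inv, norm_norm, inv_mul_cancel₀ (norm_ne_zero_iff.2 hx),
      mul_one, Real.norm_of_nonneg hr]

theorem norm_mirrorDual {k α η : ℝ} (hk : 0 < k) (hα : 0 < α) (hη : 0 < η) (w : E) :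
    ‖mirrorDual k α η w‖ = k / η * Real.log (‖w‖ / α + 1) := by
  refine norm_smul_inv_norm_smul ?_ ?_
  · have : 0 ≤ Real.log (‖w‖ / α + 1) :=
      Real.log_nonneg (by linarith [div_nonneg (norm_nonneg w) hα.le])
    positivity
  · rintro rfl
    simp

theorem exp_norm_mirrorDual {k α η : ℝ} (hk : 0 < k) (hα : 0 < α) (hη : 0 < η) (w : E) :
    α * Real.exp (η / k * ‖mirrorDual k α η w‖) = ‖w‖ + α := by
  rw [norm_mirrorDual hk hα hη, ← mul_assoc, show η / k * (k / η) = 1 by field_simp, one_mul,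
    Real.exp_log (by positivity)]
  field_simp

/-- Smoothness of the radial function `p ↦ exp ‖p‖ - ‖p‖ - 1`. -/
theorem exp_norm_sub_le (p g : E) :
    Real.exp ‖p - g‖ - ‖p - g‖ - 1 ≤
      (Real.exp ‖p‖ - ‖p‖ - 1) - (Real.exp ‖p‖ - 1) * inner ℝ (‖p‖⁻¹ • p) g
        + Real.exp (‖p‖ + ‖g‖) * ‖g‖ ^ 2 / 2 := by
  set x : ℝ := inner ℝ (‖p‖⁻¹ • p) g with hx
  have hpx : ‖p‖ * x = inner ℝ p g := by
    by_cases hp : p = 0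
    · simp [hp]
    · rw [hx, real_inner_smul_left, mul_inv_cancel_left₀ (norm_ne_zero_iff.2 hp)]
  have hxg : |x| ≤ ‖g‖ := by
    refine (abs_real_inner_le_norm _ _).trans ?_
    have : ‖‖p‖⁻¹ • p‖ ≤ 1 := by
      rw [norm_smul, norm_inv, norm_norm]
      exact inv_mul_le_one
    nlinarith [norm_nonneg g]
  have hsq : ‖p - g‖ ^ 2 = |‖p‖ - x| ^ 2 + (‖g‖ ^ 2 - x ^ 2) := by
    rw [norm_sub_sq_real, sq_abs, ← hpx]
    ring
  have hx2 : x ^ 2 ≤ ‖g‖ ^ 2 := by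
    rw [← sq_abs x]
    exact pow_le_pow_left₀ (abs_nonneg x) hxg 2
  have hle : |‖p‖ - x| ≤ ‖p - g‖ := by
    refine le_of_sq_le_sq ?_ (norm_nonneg _)
    linarith
  have h1 := exp_sub_sub_one_sub_le (abs_nonneg (‖p‖ - x)) hle
  have h2 := exp_abs_sub_le (x := x) (norm_nonneg p)
  have h3 : Real.exp ‖p - g‖ ≤ Real.exp (‖p‖ + ‖g‖) := Real.exp_le_exp.2 (norm_sub_le p g)
  have h4 : Real.exp (‖p‖ + |x|) ≤ Real.exp (‖p‖ + ‖g‖) := Real.exp_le_exp.2 (by linarith)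
  have h5 : ‖p - g‖ ^ 2 - |‖p‖ - x| ^ 2 = ‖g‖ ^ 2 - x ^ 2 := by linarith
  rw [h5] at h1
  nlinarith [mul_le_mul_of_nonneg_right h3 (sub_nonneg.2 hx2),
    mul_le_mul_of_nonneg_right h4 (sq_nonneg x)]

theorem dualPotential_norm_sub_le {k α η : ℝ} (hk : 0 < k) (hα : 0 < α) (hη : 0 < η) (w g : E) :
    dualPotential k α η ‖mirrorDual k α η w - g‖ ≤
      dualPotential k α η ‖mirrorDual k α η w‖ - inner ℝ g w
        + η / k / 2 * Real.exp (η / k * ‖g‖) * (‖w‖ + α) * ‖g‖ ^ 2 := by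
  set p := mirrorDual k α η w with hp
  have hb : 0 < η / k := by positivity
  have hnorm : ∀ q : E, ‖(η / k) • q‖ = η / k * ‖q‖ := fun q => by
    rw [norm_smul, Real.norm_of_nonneg hb.le]
  have h := exp_norm_sub_le ((η / k) • p) ((η / k) • g)
  rw [← smul_sub, hnorm, hnorm, hnorm] at h
  have hexp := exp_norm_mirrorDual hk hα hη w
  rw [← hp] at hexp
  -- the gradient of the potential at `p` is `w`
  have hgrad : α * (Real.exp (η / k * ‖p‖) - 1) *
      inner ℝ ((η / k * ‖p‖)⁻¹ • (η / k) • p) ((η / k) • g) = η / k * inner ℝ g w := by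
    by_cases hw : w = 0
    · simp [hp, hw, mirrorDual]
    · have hw' : 0 < ‖w‖ := norm_pos_iff.2 hw
      have hlog : 0 < Real.log (‖w‖ / α + 1) :=
        Real.log_pos (by linarith [div_pos hw' hα])
      have hpn : ‖p‖ = k / η * Real.log (‖w‖ / α + 1) := norm_mirrorDual hk hα hη w
      have hpos : 0 < ‖p‖ := by rw [hpn]; positivity
      have hdir : (η / k * ‖p‖)⁻¹ • (η / k) • p = ‖w‖⁻¹ • w := by
        have hp2 : p = ‖p‖ • (‖w‖⁻¹ • w) := by rw [hpn]; rfl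
        rw [smul_smul]
        nth_rewrite 2 [hp2]
        rw [smul_smul]
        have : (η / k * ‖p‖)⁻¹ * (η / k) * ‖p‖ = 1 := by field_simp
        rw [this, one_smul]
      rw [hdir, real_inner_smul_left, real_inner_smul_right, real_inner_comm g w,
        mul_sub, hexp]
      field_simp
      ring
  have h2 := mul_le_mul_of_nonneg_left h (by positivity : 0 ≤ α * (k / η))
  have e1 : α * (k / η) * ((Real.exp (η / k * ‖p‖) - 1) *
      inner ℝ ((η / k * ‖p‖)⁻¹ • (η / k) • p) ((η / k) • g)) = inner ℝ g w := by
    calc _ = k / η * (α * (Real.exp (η / k * ‖p‖) - 1) *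
      inner ℝ ((η / k * ‖p‖)⁻¹ • (η / k) • p) ((η / k) • g)) := by ring
      _ = _ := by rw [hgrad]; field_simp
  have e2 : α * (k / η) * (Real.exp (η / k * ‖p‖ + η / k * ‖g‖) * (η / k * ‖g‖) ^ 2 / 2)
      = η / k / 2 * Real.exp (η / k * ‖g‖) * (‖w‖ + α) * ‖g‖ ^ 2 := by
    rw [← hexp, Real.exp_add]
    field_simp
  unfold dualPotential
  rw [mul_add, mul_sub _ _ ((Real.exp (η / k * ‖p‖) - 1) * _), e1, e2] at h2
  exact h2

theorem dualPotential_add_le {k α η r s : ℝ} (hk : 0 < k) (hα : 0 < α) (hη : 0 < η) :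
    dualPotential k α η r + α * (Real.exp (η / k * r) - 1) * (s - r) ≤ dualPotential k α η s := by
  have h1 : η / k * (s - r) + 1 ≤ Real.exp (η / k * (s - r)) := Real.add_one_le_exp _
  have h2 : Real.exp (η / k * s) = Real.exp (η / k * r) * Real.exp (η / k * (s - r)) := by
    rw [← Real.exp_add]
    congr 1
    ring
  have h3 := mul_le_mul_of_nonneg_left h1 (Real.exp_pos (η / k * r)).le
  rw [← h2] at h3
  have h4 := mul_le_mul_of_nonneg_left h3 (by positivity : 0 ≤ α * (k / η))
  have h5 : α * (k / η) * (Real.exp (η / k * r) * (η / k * (s - r) + 1)) =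
      α * Real.exp (η / k * r) * (s - r) + α * (k / η) * Real.exp (η / k * r) := by
    field_simp
  have h6 : α * (k / η) * (η / k * (s - r)) = α * (s - r) := by field_simp
  unfold dualPotential
  nlinarith

/-- Fenchel-Young inequality for the regularizer of the base algorithm. -/
theorem inner_le_dualPotential_add {k α η : ℝ} (hk : 0 < k) (hα : 0 < α) (hη : 0 < η) (p u : E) :
    inner ℝ p u ≤ dualPotential k α η ‖p‖ + k / η * (‖u‖ * Real.log (‖u‖ / α + 1)) := by
  refine (real_inner_le_norm p u).trans ?_
  have h1 := mul_le_exp_add_mul_log (x := η / k * ‖p‖) (y := ‖u‖ / α) (by positivity)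
  have h2 := mul_le_mul_of_nonneg_left h1 (by positivity : 0 ≤ α * (k / η))
  have h3 : α * (k / η) * (η / k * ‖p‖ * (‖u‖ / α)) = ‖p‖ * ‖u‖ := by field_simp
  have h4 : α * (k / η) * (‖u‖ / α * Real.log (‖u‖ / α + 1)) =
      k / η * (‖u‖ * Real.log (‖u‖ / α + 1)) := by field_simp
  rw [mul_add, h3, h4] at h2
  exact h2

/-- One update in the dual space: the dual point moves by the loss vector and a further vector `z`
that is a subgradient of the composite term `(η/2 ‖g‖² + γ) ‖·‖` at the new iterate. -/
theorem exists_mirrorDual_baseStep {k α γ η : ℝ} (hk : 0 < k) (hα : 0 < α) (hη : 0 < η)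
    (hγ : 0 < γ) (g w : E) :
    ∃ z : E, mirrorDual k α η (baseStep k α γ η g w) = mirrorDual k α η w - g - z ∧
      ‖z‖ ≤ η / 2 * ‖g‖ ^ 2 + γ ∧
      dualPotential k α η ‖mirrorDual k α η (baseStep k α γ η g w)‖ ≤
        dualPotential k α η ‖mirrorDual k α η w - g‖
          - (η / 2 * ‖g‖ ^ 2 + γ) * ‖baseStep k α γ η g w‖ ∧
      ‖mirrorDual k α η (baseStep k α γ η g w)‖ ≤ ‖mirrorDual k α η w - g‖ := by
  set c := η / 2 * ‖g‖ ^ 2 + γ with hc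
  have hc0 : 0 < c := by positivity
  set θ := mirrorDual k α η w - g with hθ
  set r := max (‖θ‖ - c) 0 with hr
  have hr0 : 0 ≤ r := le_max_right _ _
  have hb : 0 < η / k := by positivity
  have hθr : θ = 0 → r = 0 := by
    intro h
    rw [hr, h, norm_zero]
    exact max_eq_right (by linarith)
  have hw' : baseStep k α γ η g w = (α * (Real.exp (η / k * r) - 1)) • (‖θ‖⁻¹ • θ) := by
    have : max (Real.exp (η / k * (‖θ‖ - η / 2 * ‖g‖ ^ 2 - γ)) - 1) 0 =
        Real.exp (η / k * r) - 1 := by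
      have e : ‖θ‖ - η / 2 * ‖g‖ ^ 2 - γ = ‖θ‖ - c := by rw [hc]; ring
      rw [e]
      rcases le_total (‖θ‖ - c) 0 with h | h
      · rw [hr, max_eq_right h, mul_zero, Real.exp_zero, sub_self]
        refine max_eq_right ?_
        have := Real.exp_le_one_iff.2 (mul_nonpos_of_nonneg_of_nonpos hb.le h)
        linarith
      · rw [hr, max_eq_left h]
        refine max_eq_left ?_
        have := Real.one_le_exp (mul_nonneg hb.le h)
        linarith
    rw [← this]
    rfl
  have hcoef : 0 ≤ α * (Real.exp (η / k * r) - 1) := by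
    have := Real.one_le_exp (mul_nonneg hb.le hr0)
    exact mul_nonneg hα.le (by linarith)
  have hnw' : ‖baseStep k α γ η g w‖ = α * (Real.exp (η / k * r) - 1) := by
    rw [hw']
    refine norm_smul_inv_norm_smul hcoef fun h => ?_
    simp [hθr h]
  have hlog : k / η * Real.log (‖baseStep k α γ η g w‖ / α + 1) = r := by
    rw [hnw', mul_div_cancel_left₀ _ hα.ne', sub_add_cancel, Real.log_exp]
    field_simp
  have hdual : mirrorDual k α η (baseStep k α γ η g w) = r • (‖θ‖⁻¹ • θ) := by
    unfold mirrorDual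
    rw [hlog]
    rcases hr0.eq_or_lt with h0 | h0
    · simp [← h0]
    · congr 1
      have hpos : 0 < α * (Real.exp (η / k * r) - 1) := by
        have := Real.one_lt_exp_iff.2 (mul_pos hb h0)
        exact mul_pos hα (by linarith)
      rw [hnw', hw', smul_smul, inv_mul_cancel₀ hpos.ne', one_smul]
  have hθself : ‖θ‖ • (‖θ‖⁻¹ • θ) = θ := by
    by_cases h : θ = 0
    · simp [h]
    · rw [smul_smul, mul_inv_cancel₀ (norm_ne_zero_iff.2 h), one_smul]
  have hrθ : r ≤ ‖θ‖ := max_le (by linarith) (norm_nonneg θ)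
  refine ⟨(‖θ‖ - r) • (‖θ‖⁻¹ • θ), ?_, ?_, ?_, ?_⟩
  · rw [hdual, sub_smul, hθself]
    abel
  · rw [norm_smul_inv_norm_smul (by linarith) (fun h => by simp [h, hθr h])]
    linarith [le_max_left (‖θ‖ - c) 0]
  · rw [norm_mirrorDual hk hα hη, hlog, hnw']
    have h1 := dualPotential_add_le (r := r) (s := ‖θ‖) hk hα hη
    have h2 : α * (Real.exp (η / k * r) - 1) * (‖θ‖ - r) = c * (α * (Real.exp (η / k * r) - 1)) := by
      rcases le_total (‖θ‖ - c) 0 with h | h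
      · rw [hr, max_eq_right h]
        simp
      · rw [hr, max_eq_left h]
        ring
    linarith
  · rw [norm_mirrorDual hk hα hη, hlog]
    exact hrθ

/-- The one-round inequality of the base algorithm: the loss is paid by the decrease of the
potential, up to a term of order `η α ‖g‖²`, and `γ ‖w_{t+1}‖` is left over. -/
theorem inner_add_dualPotential_baseStep_le {α γ η L : ℝ} (hα : 0 < α) (hη : 0 < η)
    (hγ : 0 < γ) (hηL : η * L ≤ 1) (hγL : γ ≤ L) {g : E} (hg : ‖g‖ ≤ L) (w : E) :
    ∃ z : E, mirrorDual 4 α η (baseStep 4 α γ η g w) = mirrorDual 4 α η w - g - z ∧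
      ‖z‖ ≤ η / 2 * ‖g‖ ^ 2 + γ ∧
      inner ℝ g w + dualPotential 4 α η ‖mirrorDual 4 α η (baseStep 4 α γ η g w)‖ ≤
        dualPotential 4 α η ‖mirrorDual 4 α η w‖ + η / 2 * α * ‖g‖ ^ 2
          - γ * ‖baseStep 4 α γ η g w‖ := by
  obtain ⟨z, hz1, hz2, hz3, -⟩ := exists_mirrorDual_baseStep (k := 4) (by norm_num) hα hη hγ g w
  refine ⟨z, hz1, hz2, ?_⟩
  have hsm := dualPotential_norm_sub_le (k := 4) (by norm_num) hα hη w g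
  set w' := baseStep 4 α γ η g w
  have hηg : η * ‖g‖ ≤ 1 := (mul_le_mul_of_nonneg_left hg hη.le).trans hηL
  have hηγ : η * γ ≤ 1 := (mul_le_mul_of_nonneg_left hγL hη.le).trans hηL
  have hg0 := norm_nonneg g
  -- The iterate changes at most by the factor `exp 1 ≤ 4`, which is cancelled by the `1 / k` in
  -- the smoothness constant: this is where the value `k = 4` enters.
  have hstab : Real.exp (η / 4 * ‖g‖) * (‖w‖ + α) ≤ 4 * (‖w'‖ + α) := by
    have h1 : ‖mirrorDual 4 α η w‖ ≤ ‖mirrorDual 4 α η w'‖ + ‖g‖ + (η / 2 * ‖g‖ ^ 2 + γ) := by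
      have : mirrorDual 4 α η w = mirrorDual 4 α η w' + g + z := by rw [hz1]; abel
      rw [this]
      exact (norm_add_le _ _).trans (add_le_add (norm_add_le _ _) hz2)
    rw [← exp_norm_mirrorDual (k := 4) (by norm_num) hα hη w,
      ← exp_norm_mirrorDual (k := 4) (by norm_num) hα hη w']
    have h2 : Real.exp (η / 4 * ‖g‖) * Real.exp (η / 4 * ‖mirrorDual 4 α η w‖) ≤
        Real.exp 1 * Real.exp (η / 4 * ‖mirrorDual 4 α η w'‖) := by
      rw [← Real.exp_add, ← Real.exp_add]
      apply Real.exp_le_exp.2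
      have h3 := mul_le_mul_of_nonneg_left h1 (by positivity : 0 ≤ η / 4)
      nlinarith [mul_nonneg hη.le hg0]
    have h4 : Real.exp 1 ≤ 4 := by linarith [Real.exp_one_lt_d9]
    have h5 : Real.exp 1 * Real.exp (η / 4 * ‖mirrorDual 4 α η w'‖) ≤
        4 * Real.exp (η / 4 * ‖mirrorDual 4 α η w'‖) :=
      mul_le_mul_of_nonneg_right h4 (Real.exp_pos _).le
    nlinarith
  have h6 := mul_le_mul_of_nonneg_left hstab (by positivity : 0 ≤ η / 4 / 2 * ‖g‖ ^ 2)
  nlinarith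

/-! ### Dynamic regret of the base algorithm -/

/-- The complexity of a comparator sequence of `n + 1` rounds: `‖u_n‖ log (‖u_n‖ / α + 1)` for the
last comparator, plus the path length weighted by logarithms with scale `β`. -/
noncomputable def comparatorCost (n : ℕ) (α β : ℝ) (u : ℕ → E) : ℝ :=
  ‖u n‖ * Real.log (‖u n‖ / α + 1) +
    ∑ t ∈ Finset.range n, ‖u (t + 1) - u t‖ * Real.log (‖u (t + 1) - u t‖ / β + 1)

/-- The induction behind `base_regret_le`: the potential of the last dual point and its pairing with
the last comparator are kept, and so is `-γ ‖w_{n+1}‖`, which the next comparator increment uses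
up. -/
theorem base_regret_aux {α γ η L : ℝ} (hα : 0 < α) (hη : 0 < η) (hγ : 0 < γ)
    (hηL : η * L ≤ 1) (hγL : γ ≤ L) {g w : ℕ → E} (hw0 : w 0 = 0)
    (hw : ∀ t, w (t + 1) = baseStep 4 α γ η (g t) (w t)) (u : ℕ → E) (n : ℕ)
    (hg : ∀ t ≤ n, ‖g t‖ ≤ L) :
    ∑ t ∈ Finset.range (n + 1), inner ℝ (g t) (w t - u t)
        + dualPotential 4 α η ‖mirrorDual 4 α η (w (n + 1))‖ ≤
      inner ℝ (mirrorDual 4 α η (w (n + 1))) (u n)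
        + 4 / η * ∑ t ∈ Finset.range n,
            ‖u (t + 1) - u t‖ * Real.log (‖u (t + 1) - u t‖ / (γ * α * η / 4) + 1)
        + ∑ t ∈ Finset.range (n + 1), (η / 2 * ‖g t‖ ^ 2 + γ) * ‖u t‖
        + η / 2 * α * ∑ t ∈ Finset.range (n + 1), ‖g t‖ ^ 2 - γ * ‖w (n + 1)‖ := by
  have hzu : ∀ {z : E} {c : ℝ} (x : E), ‖z‖ ≤ c → inner ℝ z x ≤ c * ‖x‖ := fun x hz =>
    (real_inner_le_norm _ _).trans (mul_le_mul_of_nonneg_right hz (norm_nonneg x))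
  induction n with
  | zero =>
    obtain ⟨z, hz1, hz2, hz3⟩ :=
      inner_add_dualPotential_baseStep_le hα hη hγ hηL hγL (hg 0 le_rfl) (w 0)
    rw [← hw 0] at hz1 hz3
    have hp0 : mirrorDual 4 α η (w 0) = 0 := by rw [hw0]; simp [mirrorDual]
    have hpot : dualPotential 4 α η ‖mirrorDual 4 α η (w 0)‖ = 0 := by
      rw [hp0]; simp [dualPotential]
    rw [hpot] at hz3
    rw [hp0] at hz1
    have hgz : g 0 = -mirrorDual 4 α η (w (0 + 1)) - z := by rw [hz1]; abel
    have e : inner ℝ (g 0) (u 0) = -inner ℝ (mirrorDual 4 α η (w (0 + 1))) (u 0) - inner ℝ z (u 0) := by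
      conv_lhs => rw [hgz]
      rw [inner_sub_left, inner_neg_left]
    simp only [zero_add, Finset.sum_range_one, Finset.range_zero, Finset.sum_empty, mul_zero,
      add_zero, inner_sub_right] at e hz3 ⊢
    linarith [hzu (u 0) hz2]
  | succ n ih =>
    have ih := ih fun t ht => hg t (by omega)
    obtain ⟨z, hz1, hz2, hz3⟩ :=
      inner_add_dualPotential_baseStep_le hα hη hγ hηL hγL (hg (n + 1) le_rfl) (w (n + 1))
    rw [← hw (n + 1)] at hz1 hz3
    set p := mirrorDual 4 α η (w (n + 1)) with hp
    set p' := mirrorDual 4 α η (w (n + 1 + 1))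
    have e : inner ℝ (g (n + 1)) (u (n + 1)) =
        inner ℝ p (u (n + 1)) - inner ℝ p' (u (n + 1)) - inner ℝ z (u (n + 1)) := by
      rw [← inner_sub_left, ← inner_sub_left]
      congr 1
      rw [hz1]
      abel
    have e2 : inner ℝ p (u n) = inner ℝ p (u (n + 1)) - inner ℝ p (u (n + 1) - u n) := by
      rw [inner_sub_right]; ring
    have h3 : -inner ℝ p (u (n + 1) - u n) ≤
        4 / η * Real.log (‖w (n + 1)‖ / α + 1) * ‖u (n + 1) - u n‖ := by
      rw [← norm_mirrorDual (by norm_num) hα hη, ← inner_neg_left]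
      refine (real_inner_le_norm _ _).trans ?_
      rw [norm_neg]
    have h4 := mul_log_sub_le (a := 4 / η * ‖u (n + 1) - u n‖) (x := ‖w (n + 1)‖) (by positivity)
      (norm_nonneg _) hα hγ
    have e3 : 4 / η * ‖u (n + 1) - u n‖ / (γ * α) = ‖u (n + 1) - u n‖ / (γ * α * η / 4) := by
      field_simp
    rw [e3] at h4
    rw [Finset.sum_range_succ _ (n + 1),
      Finset.sum_range_succ (fun t => ‖u (t + 1) - u t‖ * _) n,
      Finset.sum_range_succ (fun t => (η / 2 * ‖g t‖ ^ 2 + γ) * ‖u t‖) (n + 1),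
      Finset.sum_range_succ (fun t => ‖g t‖ ^ 2) (n + 1), inner_sub_right (g (n + 1))]
    have h5 := hzu (u (n + 1)) hz2
    nlinarith

/-- Dynamic regret of the base algorithm with step size `η`. -/
theorem base_regret_le {α γ η L : ℝ} (hα : 0 < α) (hη : 0 < η) (hγ : 0 < γ)
    (hηL : η * L ≤ 1) (hγL : γ ≤ L) {g w : ℕ → E} (hw0 : w 0 = 0)
    (hw : ∀ t, w (t + 1) = baseStep 4 α γ η (g t) (w t)) (u : ℕ → E) (n : ℕ)
    (hg : ∀ t ≤ n, ‖g t‖ ≤ L) :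
    ∑ t ∈ Finset.range (n + 1), inner ℝ (g t) (w t - u t) ≤
      4 / η * comparatorCost n α (γ * α * η / 4) u
        + ∑ t ∈ Finset.range (n + 1), (η / 2 * ‖g t‖ ^ 2 + γ) * ‖u t‖
        + η / 2 * α * ∑ t ∈ Finset.range (n + 1), ‖g t‖ ^ 2 := by
  have h1 := base_regret_aux hα hη hγ hηL hγL hw0 hw u n hg
  have h2 := inner_le_dualPotential_add (k := 4) (by norm_num) hα hη
    (mirrorDual 4 α η (w (n + 1))) (u n)
  have h3 : 0 ≤ γ * ‖w (n + 1)‖ := by positivity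
  unfold comparatorCost
  rw [mul_add]
  linarith

/-- The iterates of the base algorithm stay in a ball that depends only on the number of rounds. -/
theorem norm_baseIterate_le {α γ η L : ℝ} (hα : 0 < α) (hη : 0 < η) (hγ : 0 < γ)
    {g w : ℕ → E} (hw0 : w 0 = 0)
    (hw : ∀ t, w (t + 1) = baseStep 4 α γ η (g t) (w t)) (n : ℕ)
    (hg : ∀ t < n, ‖g t‖ ≤ L) :
    ‖w n‖ ≤ α * Real.exp (η / 4 * (n * L)) := by
  have key : ‖mirrorDual 4 α η (w n)‖ ≤ n * L := by
    induction n with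
    | zero => simp [hw0, mirrorDual]
    | succ n ih =>
      have ih := ih fun t ht => hg t (by omega)
      obtain ⟨-, -, -, -, h⟩ :=
        exists_mirrorDual_baseStep (k := 4) (by norm_num) hα hη hγ (g n) (w n)
      rw [hw n]
      push_cast
      linarith [norm_sub_le (mirrorDual 4 α η (w n)) (g n), hg n (by omega)]
  have := exp_norm_mirrorDual (k := 4) (by norm_num) hα hη (w n)
  have h2 : Real.exp (η / 4 * ‖mirrorDual 4 α η (w n)‖) ≤ Real.exp (η / 4 * (n * L)) :=
    Real.exp_le_exp.2 (mul_le_mul_of_nonneg_left key (by positivity))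
  nlinarith
end Base

/-! ### Dynamic regret of the algorithm with all step sizes -/

section Cost

variable {E : Type*} [NormedAddCommGroup E]

theorem comparatorCost_nonneg {n : ℕ} {α β : ℝ} (hα : 0 < α) (hβ : 0 < β) (u : ℕ → E) :
    0 ≤ comparatorCost n α β u := by
  have h : ∀ (x c : ℝ), 0 ≤ x → 0 < c → 0 ≤ x * Real.log (x / c + 1) := fun x c hx hc =>
    mul_nonneg hx (Real.log_nonneg (by linarith [div_nonneg hx hc.le]))
  exact add_nonneg (h _ _ (norm_nonneg _) hα)
    (Finset.sum_nonneg fun t _ => h _ _ (norm_nonneg _) hβ)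

theorem comparatorCost_anti {n : ℕ} {α β β' : ℝ} (hβ : 0 < β) (h : β ≤ β') (u : ℕ → E) :
    comparatorCost n α β' u ≤ comparatorCost n α β u := by
  unfold comparatorCost
  gcongr
  have : 0 < β' := hβ.trans_le h
  positivity

end Cost


theorem stepSizes_bounds {T : ℕ} (hT : 1 ≤ T) {L : ℝ} (hL : 0 < L) {η : ℝ}
    (hη : η ∈ stepSizes T L) : 0 < η ∧ η * L ≤ 1 ∧ 1 / (T * L) ≤ η := by
  have hT0 : (1 : ℝ) ≤ T := by exact_mod_cast hT
  obtain ⟨i, -, rfl⟩ := Finset.mem_image.1 hη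
  refine ⟨by positivity, ?_, ?_⟩
  · calc _ ≤ 1 / L * L := mul_le_mul_of_nonneg_right (min_le_right _ _) hL.le
      _ = 1 := by field_simp
  · refine le_min ?_ ?_
    · gcongr
      exact one_le_pow₀ (by norm_num)
    · gcongr
      nlinarith

/-- The step sizes below `1 / L` form a geometric sequence, so that the sum of all step sizes does
not depend on the horizon. -/
theorem sum_stepSizes_le {T : ℕ} (hT : 1 ≤ T) {L : ℝ} (hL : 0 < L) :
    ∑ η ∈ stepSizes T L, η ≤ 3 / L := by
  classical
  have hT0 : (1 : ℝ) ≤ T := by exact_mod_cast hT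
  set F : Finset ℕ := (Finset.range (T + 1)).filter fun i => 2 ^ i < T
  have hsub : stepSizes T L ⊆ insert (1 / L) (F.image fun i : ℕ => (2 : ℝ) ^ i / (T * L)) := by
    intro η hη
    obtain ⟨i, hi, rfl⟩ := Finset.mem_image.1 hη
    by_cases h : 2 ^ i < T
    · rw [min_eq_left]
      · exact Finset.mem_insert_of_mem
          (Finset.mem_image_of_mem _ (Finset.mem_filter.2 ⟨hi, h⟩))
      · have : (2 : ℝ) ^ i ≤ T := by exact_mod_cast h.le
        rw [div_le_div_iff₀ (by positivity) hL]
        nlinarith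
    · rw [min_eq_right]
      · exact Finset.mem_insert_self _ _
      · have : (T : ℝ) ≤ 2 ^ i := by exact_mod_cast not_lt.1 h
        rw [div_le_div_iff₀ hL (by positivity)]
        nlinarith
  have hgeom : ∑ i ∈ F, (2 : ℝ) ^ i ≤ 2 * T := by
    have h1 : ∑ i ∈ F, 2 ^ i < 2 ^ (Nat.log 2 T + 1) := by
      refine Nat.geomSum_lt le_rfl fun i hi => ?_
      have := (Finset.mem_filter.1 hi).2
      exact Nat.lt_succ_of_le (Nat.le_log_of_pow_le (by norm_num) this.le)
    have h2 : 2 ^ Nat.log 2 T ≤ T := Nat.pow_log_le_self 2 (by omega)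
    have h3 : ∑ i ∈ F, 2 ^ i ≤ 2 * T := by
      rw [pow_succ] at h1
      omega
    exact_mod_cast h3
  calc ∑ η ∈ stepSizes T L, η
      ≤ ∑ η ∈ insert (1 / L) (F.image fun i : ℕ => (2 : ℝ) ^ i / (T * L)), η := by
        refine Finset.sum_le_sum_of_subset_of_nonneg hsub fun η hη _ => ?_
        rcases Finset.mem_insert.1 hη with rfl | h
        · positivity
        · obtain ⟨i, -, rfl⟩ := Finset.mem_image.1 h
          positivity
    _ ≤ 1 / L + ∑ i ∈ F, (2 : ℝ) ^ i / (T * L) := by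
        have himage : ∑ η ∈ F.image fun i : ℕ => (2 : ℝ) ^ i / (T * L), η ≤
            ∑ i ∈ F, (2 : ℝ) ^ i / (T * L) :=
          Finset.sum_image_le_of_nonneg (g := fun i : ℕ => (2 : ℝ) ^ i / (T * L))
            (f := fun η : ℝ => η) fun η hη => by
              obtain ⟨i, -, rfl⟩ := Finset.mem_image.1 hη
              positivity
        have hL1 : 0 < 1 / L := by positivity
        by_cases h : 1 / L ∈ F.image fun i : ℕ => (2 : ℝ) ^ i / (T * L)
        · rw [Finset.insert_eq_of_mem h]
          linarith
        · rw [Finset.sum_insert h]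
          linarith
    _ ≤ 1 / L + 2 * T / (T * L) := by
        rw [← Finset.sum_div]
        gcongr
    _ = 3 / L := by
        field_simp
        norm_num

/-- Some step size of the grid balances the two terms of the regret of a base algorithm; the
boundary cases produce the two terms linear in `L`. -/
theorem exists_stepSize {T : ℕ} (hT : 1 ≤ T) {L Q S M : ℝ} (hL : 0 < L) (hQ : 0 ≤ Q)
    (hS0 : 0 ≤ S) (hS : S ≤ L ^ 2 * T * M) :
    ∃ η ∈ stepSizes T L, 4 / η * Q + η / 2 * S ≤ 5 * √(Q * S) + 8 * L * Q + L * M := by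
  have hT0 : (1 : ℝ) ≤ T := by exact_mod_cast hT
  have hsq : 0 ≤ √(Q * S) := Real.sqrt_nonneg _
  have hM : 0 ≤ L * M := by
    by_contra h
    have h1 : L * M < 0 := not_le.1 h
    have : L ^ 2 * T * M = (L * T) * (L * M) := by ring
    have := mul_neg_of_pos_of_neg (by positivity : 0 < L * T) h1
    linarith
  by_cases h1 : Q * 8 * T ^ 2 * L ^ 2 ≤ S
  · refine ⟨1 / (T * L), ?_, ?_⟩
    · refine Finset.mem_image.2 ⟨0, Finset.mem_range.2 (by omega), ?_⟩
      rw [pow_zero, min_eq_left]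
      gcongr
      nlinarith
    · have e1 : 4 / (1 / (T * L)) * Q = (Q * 8 * T ^ 2 * L ^ 2) / (2 * T * L) := by
        field_simp
        ring
      have e2 : 1 / (T * L) / 2 * S = S / (2 * T * L) := by field_simp
      have e3 : (Q * 8 * T ^ 2 * L ^ 2) / (2 * T * L) ≤ S / (2 * T * L) := by gcongr
      have e4 : S / (2 * T * L) ≤ (L ^ 2 * T * M) / (2 * T * L) := by gcongr
      have e5 : (L ^ 2 * T * M) / (2 * T * L) = L * M / 2 := by field_simp
      rw [e1, e2]
      have : 0 ≤ 8 * L * Q := by positivity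
      linarith
  · have h1 := not_le.1 h1
    by_cases h2 : S ≤ 8 * Q * L ^ 2
    · refine ⟨1 / L, ?_, ?_⟩
      · refine Finset.mem_image.2 ⟨T, Finset.mem_range.2 (by omega), ?_⟩
        rw [min_eq_right]
        have h3 : (T : ℝ) ≤ 2 ^ T := by exact_mod_cast Nat.lt_two_pow_self.le
        rw [div_le_div_iff₀ hL (by positivity)]
        nlinarith
      · have e1 : 4 / (1 / L) * Q = 4 * L * Q := by field_simp
        have e2 : 1 / L / 2 * S ≤ 1 / L / 2 * (8 * Q * L ^ 2) := by gcongr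
        have e3 : 1 / L / 2 * (8 * Q * L ^ 2) = 4 * L * Q := by
          field_simp
          ring
        linarith
    · have h2 := not_le.1 h2
      have hSpos : 0 < S := lt_of_le_of_lt (by positivity) h2
      have hQpos : 0 < Q := by
        rcases hQ.eq_or_lt with h | h
        · rw [← h] at h1
          simp at h1
          linarith
        · exact h
      -- the optimal step size lies strictly inside the range of the grid
      set q := √(8 * Q / S) with hq
      have hqpos : 0 < q := Real.sqrt_pos.2 (by positivity)
      have hqsq : q ^ 2 = 8 * Q / S := Real.sq_sqrt (by positivity)
      have hlow : 1 ≤ q * (T * L) := by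
        have : 1 < (q * (T * L)) ^ 2 := by
          rw [mul_pow, hqsq, div_mul_eq_mul_div, one_lt_div hSpos]
          nlinarith
        by_contra h
        have h' := not_le.1 h
        nlinarith [show 0 < q * (T * L) by positivity]
      have hupp : q * L < 1 := by
        have : (q * L) ^ 2 < 1 := by
          rw [mul_pow, hqsq, div_mul_eq_mul_div, div_lt_one hSpos]
          exact h2
        by_contra h
        have h' := not_lt.1 h
        nlinarith
      obtain ⟨i, hi1, hi2⟩ := exists_nat_pow_near hlow (by norm_num : (1 : ℝ) < 2)
      have hiT : (2 : ℝ) ^ i ≤ T := by nlinarith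
      have hiT' : i < T := by
        have h3 : i < 2 ^ i := Nat.lt_two_pow_self
        have h4 : 2 ^ i ≤ T := by exact_mod_cast hiT
        omega
      have hmem : (2 : ℝ) ^ i / (T * L) ∈ stepSizes T L := by
        refine Finset.mem_image.2 ⟨i, Finset.mem_range.2 (by omega), min_eq_left ?_⟩
        rw [div_le_div_iff₀ (by positivity) hL]
        nlinarith
      refine ⟨_, hmem, ?_⟩
      set η := (2 : ℝ) ^ i / (T * L) with hη
      have hηpos : 0 < η := by positivity
      have hηq : η ≤ q := by
        rw [hη, div_le_iff₀ (by positivity)]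
        exact hi1
      have hqη : q ≤ 2 * η := by
        have : q < 2 ^ (i + 1) / (T * L) := by
          rw [lt_div_iff₀ (by positivity)]
          exact hi2
        rw [pow_succ] at this
        rw [hη]
        calc q ≤ 2 ^ i * 2 / (T * L) := this.le
          _ = _ := by ring
      have hqS : q * S = √8 * √(Q * S) := by
        rw [← Real.sqrt_mul (by norm_num), hq]
        rw [show 8 * (Q * S) = 8 * Q / S * S ^ 2 by field_simp, Real.sqrt_mul (by positivity),
          Real.sqrt_sq hSpos.le]
      have h3 : 4 / η * Q ≤ q * S := by
        rw [div_mul_eq_mul_div, div_le_iff₀ hηpos]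
        have : q * (q * S) = 8 * Q := by
          rw [← mul_assoc, ← sq, hqsq]
          field_simp
        nlinarith [mul_pos hqpos hSpos]
      have h4 : η / 2 * S ≤ q * S / 2 := by nlinarith
      have h5 : √8 ≤ 3 := by
        rw [Real.sqrt_le_left (by norm_num)]
        norm_num
      have h6 : 0 ≤ 8 * L * Q := by positivity
      nlinarith [mul_le_mul_of_nonneg_right h5 hsq]

/-- The first `t` terms of a sequence of loss vectors, most recent first. -/
def lossHistory {E : Type*} (g : ℕ → E) : ℕ → List E
  | 0 => []
  | t + 1 => g t :: lossHistory g t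

theorem metaOLO_regret_le {E : Type*} [NormedAddCommGroup E] [InnerProductSpace ℝ E]
    {T : ℕ} (hT : 1 ≤ T) {L ε M : ℝ} (hL : 0 < L) (hε : 0 < ε)
    {g : ℕ → E} (hg : ∀ t < T, ‖g t‖ ≤ L) {u : ℕ → E} (hu : ∀ t < T, ‖u t‖ ≤ M) :
    ∑ t ∈ Finset.range T, inner ℝ (g t) (dynamicMetaOLO T L ε (lossHistory g t) - u t) ≤
      5 * √(comparatorCost (T - 1) (ε / T) (ε / (4 * T ^ 3)) u *
          ∑ t ∈ Finset.range T, ‖g t‖ ^ 2 * ‖u t‖)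
        + 8 * L * comparatorCost (T - 1) (ε / T) (ε / (4 * T ^ 3)) u
        + 2 * L * M + 3 / 2 * L * ε := by
  classical
  have hT0 : (1 : ℝ) ≤ T := by exact_mod_cast hT
  set Q := comparatorCost (T - 1) (ε / T) (ε / (4 * T ^ 3)) u with hQdef
  set S := ∑ t ∈ Finset.range T, ‖g t‖ ^ 2 * ‖u t‖ with hSdef
  have hQ : 0 ≤ Q := comparatorCost_nonneg (by positivity) (by positivity) u
  have hS0 : 0 ≤ S := Finset.sum_nonneg fun t _ => by positivity
  have hgsq : ∑ t ∈ Finset.range T, ‖g t‖ ^ 2 ≤ T * L ^ 2 := by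
    calc _ ≤ ∑ t ∈ Finset.range T, L ^ 2 := Finset.sum_le_sum fun t ht =>
          pow_le_pow_left₀ (norm_nonneg _) (hg t (Finset.mem_range.1 ht)) 2
      _ = _ := by simp
  have hS : S ≤ L ^ 2 * T * M := by
    calc S ≤ ∑ t ∈ Finset.range T, L ^ 2 * M := Finset.sum_le_sum fun t ht =>
          mul_le_mul (pow_le_pow_left₀ (norm_nonneg _) (hg t (Finset.mem_range.1 ht)) 2)
            (hu t (Finset.mem_range.1 ht)) (norm_nonneg _) (by positivity)
      _ = _ := by simp; ring
  have husum : ∑ t ∈ Finset.range T, ‖u t‖ ≤ T * M := by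
    calc _ ≤ ∑ t ∈ Finset.range T, M := Finset.sum_le_sum fun t ht => hu t (Finset.mem_range.1 ht)
      _ = _ := by simp
  set W : ℝ → ℕ → E := fun η t => dynamicBaseOLO 4 (ε / T) (L / T) η (lossHistory g t)
  have hbase : ∀ η ∈ stepSizes T L, ∀ x : ℕ → E,
      ∑ t ∈ Finset.range T, inner ℝ (g t) (W η t - x t) ≤
        4 / η * comparatorCost (T - 1) (ε / T) (L / T * (ε / T) * η / 4) x
          + ∑ t ∈ Finset.range T, (η / 2 * ‖g t‖ ^ 2 + L / T) * ‖x t‖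
          + η / 2 * (ε / T) * ∑ t ∈ Finset.range T, ‖g t‖ ^ 2 := by
    intro η hη x
    obtain ⟨h1, h2, -⟩ := stepSizes_bounds hT hL hη
    have h := base_regret_le (α := ε / T) (γ := L / T) (w := W η) (by positivity) h1
      (by positivity) h2 (div_le_self hL.le hT0) rfl (fun t => rfl) x (T - 1)
      (fun t ht => hg t (by omega))
    rwa [Nat.sub_add_cancel hT] at h
  have hstab : ∀ η ∈ stepSizes T L,
      η / 2 * (ε / T) * ∑ t ∈ Finset.range T, ‖g t‖ ^ 2 ≤ η * (L ^ 2 * ε / 2) := by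
    intro η hη
    obtain ⟨h1, -, -⟩ := stepSizes_bounds hT hL hη
    calc _ ≤ η / 2 * (ε / T) * (T * L ^ 2) := by gcongr
      _ = _ := by field_simp
  obtain ⟨η, hη, htune⟩ := exists_stepSize hT hL hQ hS0 hS
  obtain ⟨hη0, hηL, hηT⟩ := stepSizes_bounds hT hL hη
  -- only the base algorithm with step size `η` is compared with `u`, the others with `0`
  have hsplit : ∑ t ∈ Finset.range T, inner ℝ (g t)
        (dynamicMetaOLO T L ε (lossHistory g t) - u t) =
      ∑ t ∈ Finset.range T, inner ℝ (g t) (W η t - u t) +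
        ∑ η' ∈ (stepSizes T L).erase η, ∑ t ∈ Finset.range T, inner ℝ (g t) (W η' t) := by
    rw [Finset.sum_comm, ← Finset.sum_add_distrib]
    refine Finset.sum_congr rfl fun t _ => ?_
    rw [← inner_sum, ← inner_add_right]
    congr 1
    have : dynamicMetaOLO T L ε (lossHistory g t) = ∑ η' ∈ stepSizes T L, W η' t := rfl
    rw [this, ← Finset.add_sum_erase _ _ hη]
    abel
  have hothers : ∀ η' ∈ (stepSizes T L).erase η,
      ∑ t ∈ Finset.range T, inner ℝ (g t) (W η' t) ≤ η' * (L ^ 2 * ε / 2) := by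
    intro η' hη'
    have h1 := hbase η' (Finset.mem_of_mem_erase hη') 0
    have h2 := hstab η' (Finset.mem_of_mem_erase hη')
    simp only [comparatorCost, Pi.zero_apply, sub_zero, norm_zero, zero_mul, mul_zero,
      Finset.sum_const_zero, zero_add, add_zero] at h1
    exact h1.trans h2
  have h3 := Finset.sum_le_sum hothers
  have h4 : ∑ η' ∈ (stepSizes T L).erase η, η' * (L ^ 2 * ε / 2) + η * (L ^ 2 * ε / 2) ≤
      3 / 2 * L * ε := by
    rw [Finset.sum_erase_add _ _ hη, ← Finset.sum_mul]
    calc _ ≤ 3 / L * (L ^ 2 * ε / 2) := by gcongr; exact sum_stepSizes_le hT hL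
      _ = _ := by field_simp
  have h5 := hbase η hη u
  have h6 := hstab η hη
  have h7 : comparatorCost (T - 1) (ε / T) (L / T * (ε / T) * η / 4) u ≤ Q := by
    refine comparatorCost_anti (by positivity) ?_ u
    calc ε / (4 * T ^ 3) = L / T * (ε / T) * (1 / (T * L)) / 4 := by field_simp
      _ ≤ _ := by gcongr
  have h8 : ∑ t ∈ Finset.range T, (η / 2 * ‖g t‖ ^ 2 + L / T) * ‖u t‖ ≤ η / 2 * S + L * M := by
    have : ∑ t ∈ Finset.range T, (η / 2 * ‖g t‖ ^ 2 + L / T) * ‖u t‖ =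
        η / 2 * S + L / T * ∑ t ∈ Finset.range T, ‖u t‖ := by
      rw [hSdef, Finset.mul_sum, Finset.mul_sum, ← Finset.sum_add_distrib]
      exact Finset.sum_congr rfl fun t _ => by ring
    rw [this]
    have : L / T * ∑ t ∈ Finset.range T, ‖u t‖ ≤ L / T * (T * M) := by gcongr
    have e : L / T * (T * M) = L * M := by field_simp
    linarith
  have h9 : 4 / η * comparatorCost (T - 1) (ε / T) (L / T * (ε / T) * η / 4) u ≤ 4 / η * Q := by
    gcongr
  rw [hsplit]
  linarith

/-! ### Removing the dimension from the logarithms -/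

theorem log_mul_add_one_le {x d : ℝ} (hx : 0 ≤ x) (hd : 0 ≤ d) (h : d ≤ x) :
    Real.log (x * d + 1) ≤ 2 * Real.log (x + 1) := by
  rw [← Real.log_rpow (by linarith)]
  apply Real.log_le_log (by positivity)
  norm_cast
  nlinarith

/-- A step of the comparator either is so long that the factor `4 d` inside the logarithm only
costs a constant factor, or so short that its contribution is negligible. -/
theorem mul_log_four_mul_le {x d : ℝ} (hx : 0 ≤ x) (hd : 1 ≤ d) :
    x * Real.log (4 * x * d + 1) ≤ 12 * (x * Real.log (x + 1)) + 6 * d := by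
  have hlog : 0 ≤ Real.log (x + 1) := Real.log_nonneg (by linarith)
  have hy : √d ^ 2 = d := Real.sq_sqrt (by linarith)
  have hy1 : 1 ≤ √d := Real.one_le_sqrt.2 hd
  rcases le_total (√d) x with h | h
  · have h1 : Real.log (4 * x * d + 1) ≤ 12 * Real.log (x + 1) := by
      have h2 : 4 * x * d + 1 ≤ (x + 1) ^ 12 := by
        have h3 : d ≤ x ^ 2 := by nlinarith
        have h4 := one_add_mul_le_pow (a := x ^ 3) (by nlinarith [pow_nonneg hx 3]) 4
        have h5 : 1 + x ^ 3 ≤ (x + 1) ^ 3 := by nlinarith [sq_nonneg x]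
        have h6 : (1 + x ^ 3) ^ 4 ≤ ((x + 1) ^ 3) ^ 4 :=
          pow_le_pow_left₀ (by positivity) h5 4
        rw [← pow_mul] at h6
        push_cast at h4
        have h7 : x * d ≤ x ^ 3 := by nlinarith
        calc 4 * x * d + 1 ≤ 1 + 4 * x ^ 3 := by linarith
          _ ≤ _ := h4.trans h6
      have := Real.log_le_log (by positivity) h2
      rwa [Real.log_pow] at this
    nlinarith
  · have h1 : Real.log (4 * x * d + 1) ≤ 6 * √d := by
      have h2 : 4 * x * d + 1 ≤ (2 * √d) ^ 3 := by
        have h3 : x * d ≤ √d ^ 3 := by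
          calc x * d ≤ √d * d := by gcongr
            _ = √d ^ 3 := by rw [pow_succ, hy]; ring
        have h4 : 1 ≤ √d ^ 3 := one_le_pow₀ hy1
        rw [mul_pow]
        linarith
      have h3 := Real.log_le_log (by positivity) h2
      rw [Real.log_pow] at h3
      have h4 := Real.log_le_sub_one_of_pos (by positivity : 0 < 2 * √d)
      push_cast at h3
      linarith
    have h2 : 0 ≤ Real.log (4 * x * d + 1) := Real.log_nonneg (by nlinarith)
    have h3 : x * Real.log (4 * x * d + 1) ≤ √d * (6 * √d) := mul_le_mul h h1 h2 (by positivity)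
    nlinarith

/-- When `d ≤ T` and the comparator is not small, replacing `ε` by `ε / d` in the logarithms
changes the cost of the comparator at most by a constant factor and the additive term `ε / T`. -/
theorem comparatorCost_div_le {E : Type*} [NormedAddCommGroup E]
    {T : ℕ} (hT : 1 ≤ T) {d ε M : ℝ} (hd : 1 ≤ d) (hdT : d ≤ T)
    (hε : 0 < ε) (u : ℕ → E) (hM : ∃ t < T, ‖u t‖ = M) (hMT : 2 * d * ε ≤ T * M) :
    comparatorCost (T - 1) (ε / d / T) (ε / d / (4 * T ^ 3)) u ≤
      16 * (comparatorCost (T - 1) (ε / T) (ε / T ^ 3) u + ε / T) := by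
  have hT0 : (1 : ℝ) ≤ T := by exact_mod_cast hT
  have hd0 : 0 < d := by linarith
  set n := T - 1 with hn
  set P := ∑ t ∈ Finset.range n, ‖u (t + 1) - u t‖ *
    Real.log (‖u (t + 1) - u t‖ / (ε / T ^ 3) + 1) with hP
  have hP0 : 0 ≤ P := Finset.sum_nonneg fun t _ =>
    mul_nonneg (norm_nonneg _) (Real.log_nonneg (by
      have : 0 ≤ ‖u (t + 1) - u t‖ / (ε / T ^ 3) := by positivity
      linarith))
  have hΦ0 : 0 ≤ ‖u n‖ * Real.log (‖u n‖ / (ε / T) + 1) :=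
    mul_nonneg (norm_nonneg _) (Real.log_nonneg (by
      have : 0 ≤ ‖u n‖ / (ε / T) := by positivity
      linarith))
  have hpath : ∑ t ∈ Finset.range n, ‖u (t + 1) - u t‖ *
      Real.log (‖u (t + 1) - u t‖ / (ε / d / (4 * T ^ 3)) + 1) ≤ 12 * P + 6 * (ε / T) := by
    have h1 : ∀ t ∈ Finset.range n, ‖u (t + 1) - u t‖ *
        Real.log (‖u (t + 1) - u t‖ / (ε / d / (4 * T ^ 3)) + 1) ≤
        12 * (‖u (t + 1) - u t‖ * Real.log (‖u (t + 1) - u t‖ / (ε / T ^ 3) + 1))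
          + 6 * (ε / T ^ 2) := by
      intro t _
      set δ := ‖u (t + 1) - u t‖
      have h2 := mul_log_four_mul_le (x := δ / (ε / T ^ 3)) (by positivity) hd
      have h3 := mul_le_mul_of_nonneg_left h2 (by positivity : 0 ≤ ε / (T : ℝ) ^ 3)
      have e1 : 4 * (δ / (ε / T ^ 3)) * d = δ / (ε / d / (4 * T ^ 3)) := by field_simp
      rw [e1] at h3
      have e2 : ∀ y : ℝ, ε / (T : ℝ) ^ 3 * (δ / (ε / T ^ 3) * y) = δ * y := by
        intro y
        field_simp
      rw [mul_add, e2, mul_left_comm, e2] at h3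
      have h4 : ε / (T : ℝ) ^ 3 * (6 * d) ≤ ε / (T : ℝ) ^ 3 * (6 * T) := by gcongr
      have e3 : ε / (T : ℝ) ^ 3 * (6 * T) = 6 * (ε / T ^ 2) := by field_simp
      linarith
    refine (Finset.sum_le_sum h1).trans ?_
    rw [Finset.sum_add_distrib, ← Finset.mul_sum, ← hP, Finset.sum_const, Finset.card_range,
      nsmul_eq_mul]
    have h5 : (n : ℝ) ≤ T := by exact_mod_cast (by omega : n ≤ T)
    have h6 : (n : ℝ) * (6 * (ε / T ^ 2)) ≤ T * (6 * (ε / T ^ 2)) := by gcongr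
    have e3 : T * (6 * (ε / T ^ 2)) = 6 * (ε / T) := by field_simp
    linarith
  have hlast : ‖u n‖ * Real.log (‖u n‖ / (ε / d / T) + 1) ≤
      2 * (‖u n‖ * Real.log (‖u n‖ / (ε / T) + 1)) + 4 * P := by
    have hMpos : 0 < M := by
      have : 0 < T * M := lt_of_lt_of_le (by positivity) hMT
      exact pos_of_mul_pos_right this (by positivity)
    have e1 : ‖u n‖ / (ε / d / T) = ‖u n‖ / (ε / T) * d := by field_simp
    rcases le_total M (2 * ‖u n‖) with h | h
    · have h1 : d ≤ ‖u n‖ / (ε / T) := by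
        rw [le_div_iff₀ (by positivity), mul_div_assoc', div_le_iff₀ (by positivity)]
        nlinarith
      have h2 := log_mul_add_one_le (by positivity) hd0.le h1
      rw [e1]
      nlinarith [mul_le_mul_of_nonneg_left h2 (norm_nonneg (u n))]
    · -- the comparator has moved a long way, and the path length pays
      obtain ⟨s, hs, hsM⟩ := hM
      set len := ∑ t ∈ Finset.range n, ‖u (t + 1) - u t‖ with hlen
      have hlen1 : M / 2 ≤ len := by
        have h1 : ‖u s - u n‖ ≤ len := by
          rw [← dist_eq_norm]
          refine (dist_le_Ico_sum_dist u (by omega : s ≤ n)).trans ?_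
          have h2 : ∑ t ∈ Finset.Ico s n, dist (u t) (u (t + 1)) ≤
              ∑ t ∈ Finset.range n, dist (u t) (u (t + 1)) := by
            refine Finset.sum_le_sum_of_subset_of_nonneg ?_ fun _ _ _ => dist_nonneg
            intro t ht
            exact Finset.mem_range.2 (Finset.mem_Ico.1 ht).2
          refine h2.trans_eq (Finset.sum_congr rfl fun t _ => ?_)
          rw [dist_comm, dist_eq_norm]
        have h3 := norm_sub_norm_le (u s) (u n)
        linarith
      have hlen0 : 0 < len := by linarith
      -- increments below half of the average are discarded: this loses half of the length and
      -- gives all the others the same logarithm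
      set τ := len / (2 * T) with hτ
      have hτ0 : 0 < τ := by positivity
      have hlogτ : 0 ≤ Real.log (τ / (ε / T ^ 3) + 1) := Real.log_nonneg (by
        have : 0 ≤ τ / (ε / T ^ 3) := by positivity
        linarith)
      have h1 : (len - n * τ) * Real.log (τ / (ε / T ^ 3) + 1) ≤ P := by
        have : (len - n * τ) * Real.log (τ / (ε / T ^ 3) + 1) =
            ∑ t ∈ Finset.range n, (‖u (t + 1) - u t‖ - τ) * Real.log (τ / (ε / T ^ 3) + 1) := by
          rw [← Finset.sum_mul, Finset.sum_sub_distrib]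
          simp [hlen]
        rw [this]
        refine Finset.sum_le_sum fun t _ => ?_
        set δ := ‖u (t + 1) - u t‖
        have hδ : 0 ≤ δ := norm_nonneg _
        have hlogδ : 0 ≤ Real.log (δ / (ε / T ^ 3) + 1) := Real.log_nonneg (by
          have : 0 ≤ δ / (ε / T ^ 3) := by positivity
          linarith)
        rcases le_total δ τ with h2 | h2
        · exact (mul_nonpos_of_nonpos_of_nonneg (by linarith) hlogτ).trans
            (mul_nonneg hδ hlogδ)
        · refine mul_le_mul (by linarith) ?_ hlogτ hδ
          gcongr
      have h2 : n * τ ≤ len / 2 := by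
        have h3 : (n : ℝ) ≤ T := by exact_mod_cast (by omega : n ≤ T)
        calc n * τ ≤ T * τ := by gcongr
          _ = len / 2 := by rw [hτ]; field_simp
      have h3 : Real.log (‖u n‖ / (ε / d / T) + 1) ≤ 2 * Real.log (τ / (ε / T ^ 3) + 1) := by
        have h4 : ‖u n‖ / (ε / d / T) ≤ 2 * (τ / (ε / T ^ 3)) := by
          have e : 2 * (τ / (ε / T ^ 3)) = len * T ^ 2 / ε := by rw [hτ]; field_simp
          have e' : ‖u n‖ / (ε / d / T) = ‖u n‖ * (d * T) / ε := by field_simp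
          rw [e, e']
          have : d * T ≤ (T : ℝ) ^ 2 := by nlinarith
          gcongr
          linarith
        have h5 : 0 ≤ τ / (ε / T ^ 3) := by positivity
        have h6 : ‖u n‖ / (ε / d / T) + 1 ≤ (τ / (ε / T ^ 3) + 1) ^ 2 := by nlinarith
        have := Real.log_le_log (by positivity) h6
        rwa [Real.log_pow] at this
      have h4 : ‖u n‖ ≤ len := by linarith
      have h5 : ‖u n‖ * Real.log (‖u n‖ / (ε / d / T) + 1) ≤
          len * (2 * Real.log (τ / (ε / T ^ 3) + 1)) := by
        refine mul_le_mul h4 h3 ?_ hlen0.le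
        refine Real.log_nonneg ?_
        have : 0 ≤ ‖u n‖ / (ε / d / T) := by positivity
        linarith
      have h6 : len / 2 * Real.log (τ / (ε / T ^ 3) + 1) ≤ P := by
        refine le_trans ?_ h1
        gcongr
        linarith
      linarith
  unfold comparatorCost
  have : 0 ≤ ε / T := by positivity
  linarith


/-! ### The loss estimates of PABLO -/

section Estimates

variable {d : ℕ}

/-- The loss estimate that PABLO forms in a round with base decision `w`, loss `l` and sampled
direction `s`. -/
noncomputable def roundEstimate (ϱ : ℝ) (w l s : EuclideanSpace ℝ (Fin d)) :
    EuclideanSpace ℝ (Fin d) :=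
  lossEstimate ϱ w s (inner ℝ l (perturbedAction ϱ w s))

theorem perturbScale_pos (hd : 1 ≤ d) {ϱ : ℝ} (hϱ : 0 < ϱ) (w : EuclideanSpace ℝ (Fin d)) :
    0 < perturbScale ϱ w := by
  have hd0 : (0 : ℝ) < d := by exact_mod_cast hd
  have : 0 < max (‖w‖ ^ 2) (ϱ ^ 2) := lt_max_of_lt_right (by positivity)
  unfold perturbScale
  positivity

theorem perturbScale_mul_norm_sq_le (hd : 1 ≤ d) {ϱ : ℝ} (hϱ : 0 < ϱ)
    (w : EuclideanSpace ℝ (Fin d)) : d * (perturbScale ϱ w * ‖w‖ ^ 2) ≤ 1 := by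
  have hd0 : (0 : ℝ) < d := by exact_mod_cast hd
  have h1 : 0 < max (‖w‖ ^ 2) (ϱ ^ 2) := lt_max_of_lt_right (by positivity)
  have h2 : ‖w‖ ^ 2 ≤ max (‖w‖ ^ 2) (ϱ ^ 2) := le_max_left _ _
  have : d * (perturbScale ϱ w * ‖w‖ ^ 2) = ‖w‖ ^ 2 / max (‖w‖ ^ 2) (ϱ ^ 2) := by
    unfold perturbScale
    field_simp
  rw [this, div_le_one h1]
  exact h2

theorem sqrt_perturbScale_mul_norm_le (hd : 1 ≤ d) {ϱ : ℝ} (hϱ : 0 < ϱ)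
    (w : EuclideanSpace ℝ (Fin d)) : √(perturbScale ϱ w) * ‖w‖ ≤ 1 := by
  have hd0 : (1 : ℝ) ≤ d := by exact_mod_cast hd
  have h1 := perturbScale_mul_norm_sq_le hd hϱ w
  have h2 := perturbScale_pos hd hϱ w
  have h3 : (√(perturbScale ϱ w) * ‖w‖) ^ 2 ≤ 1 := by
    rw [mul_pow, Real.sq_sqrt h2.le]
    nlinarith [mul_nonneg h2.le (sq_nonneg ‖w‖)]
  exact (sq_le_one_iff₀ (by positivity)).1 h3

theorem inv_sqrt_perturbScale_le {ϱ : ℝ} (hϱ : 0 < ϱ)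
    (w : EuclideanSpace ℝ (Fin d)) : (√(perturbScale ϱ w))⁻¹ ≤ √d * (‖w‖ + ϱ) := by
  unfold perturbScale
  rw [one_div, Real.sqrt_inv, inv_inv, Real.sqrt_mul (by positivity)]
  gcongr
  rw [Real.sqrt_le_left (by positivity)]
  refine max_le ?_ ?_ <;> nlinarith [norm_nonneg w]

theorem roundEstimate_eq (hd : 1 ≤ d) {ϱ : ℝ} (hϱ : 0 < ϱ) (w l s : EuclideanSpace ℝ (Fin d)) :
    roundEstimate ϱ w l s =
      ((d : ℝ) * (√(perturbScale ϱ w) * inner ℝ l w + inner ℝ l s)) • s := by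
  have h := Real.sqrt_pos.2 (perturbScale_pos hd hϱ w)
  unfold roundEstimate lossEstimate perturbedAction
  rw [inner_add_right, real_inner_smul_right]
  congr 1
  field_simp

theorem norm_roundEstimate_le (hd : 1 ≤ d) {ϱ : ℝ} (hϱ : 0 < ϱ)
    {w l s : EuclideanSpace ℝ (Fin d)} (hs : ‖s‖ = 1) :
    ‖roundEstimate ϱ w l s‖ ≤ 2 * d * ‖l‖ := by
  rw [roundEstimate_eq hd hϱ, norm_smul, hs, mul_one, Real.norm_eq_abs, abs_mul, Nat.abs_cast]
  have h1 : |√(perturbScale ϱ w) * inner ℝ l w| ≤ ‖l‖ := by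
    rw [abs_mul, abs_of_nonneg (Real.sqrt_nonneg _)]
    have h2 := mul_le_mul_of_nonneg_left (abs_real_inner_le_norm l w)
      (Real.sqrt_nonneg (perturbScale ϱ w))
    have h3 := mul_le_mul_of_nonneg_left (sqrt_perturbScale_mul_norm_le hd hϱ w) (norm_nonneg l)
    nlinarith
  have h2 : |inner ℝ l s| ≤ ‖l‖ := by
    have := abs_real_inner_le_norm l s
    rwa [hs, mul_one] at this
  have h3 : |√(perturbScale ϱ w) * inner ℝ l w + inner ℝ l s| ≤ 2 * ‖l‖ :=
    (abs_add_le _ _).trans (by linarith)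
  nlinarith [mul_le_mul_of_nonneg_left h3 (Nat.cast_nonneg (α := ℝ) d)]

theorem norm_sub_roundEstimate_le (hd : 1 ≤ d) {ϱ : ℝ} (hϱ : 0 < ϱ)
    {w l s : EuclideanSpace ℝ (Fin d)} (hs : ‖s‖ = 1) :
    ‖l - roundEstimate ϱ w l s‖ ≤ 3 * d * ‖l‖ := by
  have h := norm_roundEstimate_le (w := w) (l := l) hd hϱ hs
  have hd0 : (1 : ℝ) ≤ d := by exact_mod_cast hd
  nlinarith [norm_sub_le l (roundEstimate ϱ w l s), norm_nonneg l]

/-- The estimate is unbiased: its average over the `2 d` directions is the loss. -/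
theorem sum_inner_roundEstimate (hd : 1 ≤ d) {ϱ : ℝ} (hϱ : 0 < ϱ)
    (v : OrthonormalBasis (Fin d) ℝ (EuclideanSpace ℝ (Fin d)))
    (w l y : EuclideanSpace ℝ (Fin d)) :
    ∑ i, (inner ℝ (roundEstimate ϱ w l (v i) - l) y
      + inner ℝ (roundEstimate ϱ w l (-v i) - l) y) = 0 := by
  have h1 : ∀ i, inner ℝ (roundEstimate ϱ w l (v i) - l) y
      + inner ℝ (roundEstimate ϱ w l (-v i) - l) y =
      2 * d * (inner ℝ l (v i) * inner ℝ (v i) y) - 2 * inner ℝ l y := by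
    intro i
    rw [roundEstimate_eq hd hϱ, roundEstimate_eq hd hϱ, inner_sub_left, inner_sub_left,
      real_inner_smul_left, real_inner_smul_left, inner_neg_right, inner_neg_left]
    ring
  rw [Finset.sum_congr rfl fun i _ => h1 i, Finset.sum_sub_distrib, ← Finset.mul_sum,
    v.sum_inner_mul_inner]
  simp
  ring

/-- The second moment of the estimate is smaller by a factor of order `d` than its largest
possible square. -/
theorem sum_norm_sq_roundEstimate_le (hd : 1 ≤ d) {ϱ : ℝ} (hϱ : 0 < ϱ)
    (v : OrthonormalBasis (Fin d) ℝ (EuclideanSpace ℝ (Fin d)))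
    (w l : EuclideanSpace ℝ (Fin d)) :
    ∑ i, (‖roundEstimate ϱ w l (v i)‖ ^ 2 + ‖roundEstimate ϱ w l (-v i)‖ ^ 2) ≤
      2 * d * (2 * d * ‖l‖ ^ 2) := by
  have h1 : ∀ i, ‖roundEstimate ϱ w l (v i)‖ ^ 2 + ‖roundEstimate ϱ w l (-v i)‖ ^ 2 =
      2 * d ^ 2 * (perturbScale ϱ w * inner ℝ l w ^ 2) + 2 * d ^ 2 * inner ℝ l (v i) ^ 2 := by
    intro i
    rw [roundEstimate_eq hd hϱ, roundEstimate_eq hd hϱ, norm_smul, norm_smul, norm_neg,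
      v.norm_eq_one, mul_one, mul_one, Real.norm_eq_abs, Real.norm_eq_abs, sq_abs, sq_abs,
      inner_neg_right]
    have := Real.sq_sqrt (perturbScale_pos hd hϱ w).le
    linear_combination (2 * (d : ℝ) ^ 2 * inner ℝ l w ^ 2) * this
  have h2 : ∑ i, inner ℝ l (v i) ^ 2 = ‖l‖ ^ 2 := by
    rw [← real_inner_self_eq_norm_sq, ← v.sum_inner_mul_inner l l]
    refine Finset.sum_congr rfl fun i _ => ?_
    rw [sq, real_inner_comm l (v i)]
  have h3 : d * (perturbScale ϱ w * inner ℝ l w ^ 2) ≤ ‖l‖ ^ 2 := by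
    have h4 : inner ℝ l w ^ 2 ≤ (‖l‖ * ‖w‖) ^ 2 := by
      rw [← sq_abs]
      exact pow_le_pow_left₀ (abs_nonneg _) (abs_real_inner_le_norm l w) 2
    have h5 := perturbScale_mul_norm_sq_le hd hϱ w
    have h6 := (perturbScale_pos hd hϱ w).le
    calc d * (perturbScale ϱ w * inner ℝ l w ^ 2)
        ≤ d * (perturbScale ϱ w * (‖l‖ * ‖w‖) ^ 2) := by gcongr
      _ = (d * (perturbScale ϱ w * ‖w‖ ^ 2)) * ‖l‖ ^ 2 := by ring
      _ ≤ 1 * ‖l‖ ^ 2 := by gcongr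
      _ = ‖l‖ ^ 2 := one_mul _
  rw [Finset.sum_congr rfl fun i _ => h1 i, Finset.sum_add_distrib,
    ← Finset.mul_sum Finset.univ (fun i => inner ℝ l (v i) ^ 2), h2]
  simp only [Finset.sum_const, Finset.card_univ, Fintype.card_fin, nsmul_eq_mul]
  have h7 := mul_le_mul_of_nonneg_left h3 (by positivity : 0 ≤ 2 * (d : ℝ) ^ 2)
  nlinarith

theorem norm_eq_one_of_mem_signedBasis
    {v : OrthonormalBasis (Fin d) ℝ (EuclideanSpace ℝ (Fin d))} {x : EuclideanSpace ℝ (Fin d)}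
    (hx : x ∈ signedBasis v) : ‖x‖ = 1 := by
  obtain ⟨i, rfl | rfl⟩ := hx
  · exact v.norm_eq_one i
  · rw [norm_neg, v.norm_eq_one]

/-- The loss estimate of round `t`. -/
noncomputable def pabloEstimate (A : OLOLearner (EuclideanSpace ℝ (Fin d))) (ϱ : ℝ)
    (ℓ s : ℕ → EuclideanSpace ℝ (Fin d)) (t : ℕ) : EuclideanSpace ℝ (Fin d) :=
  roundEstimate ϱ (A (pabloHistory A ϱ ℓ s t)) (ℓ t) (s t)

theorem pabloHistory_eq_lossHistory (A : OLOLearner (EuclideanSpace ℝ (Fin d))) (ϱ : ℝ)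
    (ℓ s : ℕ → EuclideanSpace ℝ (Fin d)) (t : ℕ) :
    pabloHistory A ϱ ℓ s t = lossHistory (pabloEstimate A ϱ ℓ s) t := by
  induction t with
  | zero => rfl
  | succ t ih =>
    rw [lossHistory, ← ih]
    rfl

end Estimates

/-! ### Pathwise regret bounds with dimension-free logarithms -/

section Pathwise

variable {d : ℕ}

/-- `Φ_T + P_T^Φ`. -/
noncomputable def pathCost (T : ℕ) (ε : ℝ) (u : ℕ → EuclideanSpace ℝ (Fin d)) : ℝ :=
  phiLast T ε u + phiPathLength T ε u

/-- The largest norm of a comparator. -/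
noncomputable def maxNorm (T : ℕ) (u : ℕ → EuclideanSpace ℝ (Fin d)) : ℝ :=
  ⨆ t : Fin T, ‖u t‖

theorem pathCost_eq (T : ℕ) (ε : ℝ) (u : ℕ → EuclideanSpace ℝ (Fin d)) :
    pathCost T ε u = comparatorCost (T - 1) (ε / T) (ε / T ^ 3) u := by
  simp only [pathCost, phiLast, phiPathLength, comparatorCost, div_div_eq_mul_div]

theorem pathCost_nonneg {T : ℕ} (hT : 1 ≤ T) {ε : ℝ} (hε : 0 < ε)
    (u : ℕ → EuclideanSpace ℝ (Fin d)) : 0 ≤ pathCost T ε u := by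
  have hT0 : (0 : ℝ) < T := by exact_mod_cast hT
  rw [pathCost_eq]
  exact comparatorCost_nonneg (by positivity) (by positivity) u

theorem norm_le_maxNorm {T t : ℕ} (ht : t < T) (u : ℕ → EuclideanSpace ℝ (Fin d)) :
    ‖u t‖ ≤ maxNorm T u :=
  le_ciSup (f := fun t : Fin T => ‖u t‖) (Set.finite_range _).bddAbove ⟨t, ht⟩

theorem maxNorm_nonneg (T : ℕ) (u : ℕ → EuclideanSpace ℝ (Fin d)) : 0 ≤ maxNorm T u :=
  Real.iSup_nonneg fun _ => norm_nonneg _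

theorem exists_norm_eq_maxNorm {T : ℕ} (hT : 1 ≤ T) (u : ℕ → EuclideanSpace ℝ (Fin d)) :
    ∃ t < T, ‖u t‖ = maxNorm T u := by
  have : Nonempty (Fin T) := ⟨⟨0, hT⟩⟩
  obtain ⟨t, ht⟩ := exists_eq_ciSup_of_finite (f := fun t : Fin T => ‖u t‖)
  exact ⟨t, t.2, ht⟩

theorem dynamicBound_eq (κ : ℝ) (T : ℕ) (G ε : ℝ) (q : ℕ → ℝ)
    (u : ℕ → EuclideanSpace ℝ (Fin d)) :
    dynamicBound κ T G ε q u =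
      d / κ * √(pathCost T ε u * ∑ t ∈ Finset.range T, q t * ‖u t‖)
        + d * G * (ε + maxNorm T u + pathCost T ε u) := by
  simp only [dynamicBound, pathCost, maxNorm, ← add_assoc]

/-- A comparator sequence is negligible if its total loss is within the additive terms of the
regret bound; the regret against it is then controlled by the regret against `0`. -/
def IsNegligible (T : ℕ) (ε : ℝ) (u : ℕ → EuclideanSpace ℝ (Fin d)) : Prop :=
  T * maxNorm T u ≤ d * (2 * ε + maxNorm T u)

theorem regret_zero_le (hd : 1 ≤ d) {T : ℕ} (hT : 1 ≤ T) {G ε : ℝ} (hG : 0 < G) (hε : 0 < ε)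
    {g : ℕ → EuclideanSpace ℝ (Fin d)} (hg : ∀ t < T, ‖g t‖ ≤ 3 * d * G) :
    ∑ t ∈ Finset.range T, inner ℝ (g t)
        (dynamicMetaOLO T (3 * d * G) (ε / d) (lossHistory g t)) ≤ 5 * d * G * ε := by
  have hd0 : (1 : ℝ) ≤ d := by exact_mod_cast hd
  have h := metaOLO_regret_le (M := 0) hT (by positivity : 0 < 3 * d * G)
    (by positivity : 0 < ε / d) hg (u := 0) (by simp)
  simp only [comparatorCost, Pi.zero_apply, sub_zero, norm_zero, zero_mul, mul_zero,
    Finset.sum_const_zero, add_zero, Real.sqrt_zero, zero_add] at h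
  have e : 3 / 2 * (3 * d * G) * (ε / d) = 9 / 2 * (G * ε) := by
    field_simp
    norm_num
  have : 0 < G * ε := by positivity
  rw [e] at h
  nlinarith

theorem regret_le_of_not_isNegligible (hd : 1 ≤ d) {T : ℕ} (hT : 1 ≤ T) {G ε : ℝ} (hG : 0 < G)
    (hε : 0 < ε) {g : ℕ → EuclideanSpace ℝ (Fin d)} (hg : ∀ t < T, ‖g t‖ ≤ 3 * d * G)
    {u : ℕ → EuclideanSpace ℝ (Fin d)} (hu : ¬IsNegligible T ε u) :
    ∑ t ∈ Finset.range T, inner ℝ (g t)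
        (dynamicMetaOLO T (3 * d * G) (ε / d) (lossHistory g t) - u t) ≤
      20 * √((pathCost T ε u + ε / T) * ∑ t ∈ Finset.range T, ‖g t‖ ^ 2 * ‖u t‖)
        + 400 * (d * G * (ε + maxNorm T u + pathCost T ε u)) := by
  have hd0 : (1 : ℝ) ≤ d := by exact_mod_cast hd
  have hT0 : (1 : ℝ) ≤ T := by exact_mod_cast hT
  set M := maxNorm T u with hM
  set Q := pathCost T ε u with hQ
  have hM0 : 0 ≤ M := maxNorm_nonneg T u
  have hQ0 : 0 ≤ Q := pathCost_nonneg hT hε u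
  have hneg : d * (2 * ε + M) < T * M := not_le.1 hu
  have hdT : (d : ℝ) ≤ T := by
    by_contra h
    have h' := (not_le.1 h).le
    have : 0 < d * (2 * ε) := by positivity
    nlinarith [mul_le_mul_of_nonneg_right h' hM0]
  have h1 := metaOLO_regret_le hT (by positivity : 0 < 3 * d * G) (by positivity : 0 < ε / d) hg
    (fun t ht => norm_le_maxNorm ht u)
  have h2 := comparatorCost_div_le hT hd0 hdT hε u (exists_norm_eq_maxNorm hT u)
    (by nlinarith [mul_nonneg (by linarith : (0 : ℝ) ≤ d) hM0])
  rw [← pathCost_eq, ← hQ] at h2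
  rw [← hM] at h1
  set Q' := comparatorCost (T - 1) (ε / d / T) (ε / d / (4 * T ^ 3)) u
  set S := ∑ t ∈ Finset.range T, ‖g t‖ ^ 2 * ‖u t‖
  have hS : 0 ≤ S := Finset.sum_nonneg fun t _ => by positivity
  have h3 : √(Q' * S) ≤ 4 * √((Q + ε / T) * S) := by
    have : √(Q' * S) ≤ √(4 ^ 2 * ((Q + ε / T) * S)) := by
      apply Real.sqrt_le_sqrt
      nlinarith [mul_le_mul_of_nonneg_right h2 hS]
    rwa [Real.sqrt_mul (by norm_num : (0 : ℝ) ≤ 4 ^ 2), Real.sqrt_sq (by norm_num)] at this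
  have h4 : ε / T ≤ ε := div_le_self hε.le hT0
  have hdG : 0 < d * G := by positivity
  have h5 : 8 * (3 * d * G) * Q' ≤ 8 * (3 * d * G) * (16 * (Q + ε)) := by
    gcongr
    linarith
  have e : 3 / 2 * (3 * d * G) * (ε / d) = 9 / 2 * (G * ε) := by
    field_simp
    norm_num
  have h6 : G * ε ≤ d * G * ε := by nlinarith [mul_pos hG hε]
  rw [e] at h1
  have h7 := mul_nonneg hdG.le hM0
  have h8 := mul_nonneg hdG.le hQ0
  have h9 := mul_pos hdG hε
  nlinarith

theorem neg_sum_inner_le_of_isNegligible {T : ℕ} {G ε : ℝ} (hG : 0 < G)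
    {ℓ u : ℕ → EuclideanSpace ℝ (Fin d)} (hℓ : ∀ t < T, ‖ℓ t‖ ≤ G) (hu : IsNegligible T ε u) :
    -∑ t ∈ Finset.range T, inner ℝ (ℓ t) (u t) ≤ d * G * (2 * ε + maxNorm T u) := by
  have h1 : -∑ t ∈ Finset.range T, inner ℝ (ℓ t) (u t) ≤
      ∑ t ∈ Finset.range T, G * maxNorm T u := by
    rw [← Finset.sum_neg_distrib]
    refine Finset.sum_le_sum fun t ht => ?_
    have ht := Finset.mem_range.1 ht
    rw [← inner_neg_left]
    refine (real_inner_le_norm _ _).trans ?_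
    rw [norm_neg]
    exact mul_le_mul (hℓ t ht) (norm_le_maxNorm ht u) (norm_nonneg _) hG.le
  rw [Finset.sum_const, Finset.card_range, nsmul_eq_mul] at h1
  have h2 := mul_le_mul_of_nonneg_left hu hG.le
  linarith

theorem sum_mul_norm_le {T : ℕ} {q : ℕ → ℝ} {c : ℝ}
    (hq : ∀ t < T, 0 ≤ q t ∧ q t ≤ c) (u : ℕ → EuclideanSpace ℝ (Fin d)) :
    ∑ t ∈ Finset.range T, q t * ‖u t‖ ≤ c * T * maxNorm T u := by
  calc _ ≤ ∑ t ∈ Finset.range T, c * maxNorm T u := by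
        refine Finset.sum_le_sum fun t ht => ?_
        have ht := Finset.mem_range.1 ht
        exact mul_le_mul (hq t ht).2 (norm_le_maxNorm ht u) (norm_nonneg _)
          ((hq t ht).1.trans (hq t ht).2)
    _ = _ := by simp; ring

theorem sqrt_add_le_add_sqrt {x y : ℝ} (hx : 0 ≤ x) (hy : 0 ≤ y) : √(x + y) ≤ √x + √y := by
  rw [Real.sqrt_le_left (by positivity), add_sq, Real.sq_sqrt hx, Real.sq_sqrt hy]
  nlinarith [mul_nonneg (Real.sqrt_nonneg x) (Real.sqrt_nonneg y)]

/-- The surplus `ε / T` of the path cost is absorbed by the additive terms. -/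
theorem sqrt_add_mul_le {T : ℕ} (hT : 1 ≤ T) {G ε Q M X : ℝ} (hG : 0 < G) (hε : 0 < ε)
    (hQ : 0 ≤ Q) (hM : 0 ≤ M) (hX : 0 ≤ X) (hXM : X ≤ G ^ 2 * T * M) :
    √((Q + ε / T) * X) ≤ √(Q * X) + G * (ε + M) := by
  have hT0 : (1 : ℝ) ≤ T := by exact_mod_cast hT
  have h1 : √((Q + ε / T) * X) ≤ √(Q * X) + √(ε / T * X) := by
    rw [add_mul]
    exact sqrt_add_le_add_sqrt (by positivity) (by positivity)
  have h2 : √(ε / T * X) ≤ G * (ε + M) := by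
    rw [Real.sqrt_le_left (by positivity)]
    have h3 : ε / T * X ≤ ε / T * (G ^ 2 * T * M) := by gcongr
    have e : ε / T * (G ^ 2 * T * M) = G ^ 2 * (ε * M) := by field_simp
    have h4 : G ^ 2 * (ε * M) ≤ G ^ 2 * (ε + M) ^ 2 := by
      gcongr
      nlinarith [mul_nonneg hε.le hM]
    rw [mul_pow]
    linarith
  linarith

/-- Two learners, run on the estimates and on the estimation errors, together compete with an
arbitrary comparator sequence. -/
theorem adaptive_pathwise_le (hd : 1 ≤ d) {T : ℕ} (hT : 1 ≤ T) {G ε : ℝ} (hG : 0 < G)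
    (hε : 0 < ε) {ℓ e : ℕ → EuclideanSpace ℝ (Fin d)} (hℓ : ∀ t < T, ‖ℓ t‖ ≤ G)
    (he : ∀ t < T, ‖e t‖ ≤ 3 * d * ‖ℓ t‖) (he' : ∀ t < T, ‖ℓ t - e t‖ ≤ 3 * d * ‖ℓ t‖)
    (u : ℕ → EuclideanSpace ℝ (Fin d)) :
    ∑ t ∈ Finset.range T, inner ℝ (e t)
        (dynamicMetaOLO T (3 * d * G) (ε / d) (lossHistory e t)) +
      ∑ t ∈ Finset.range T, inner ℝ (ℓ t - e t)
        (dynamicMetaOLO T (3 * d * G) (ε / d) (lossHistory (fun t => ℓ t - e t) t)) -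
      ∑ t ∈ Finset.range T, inner ℝ (ℓ t) (u t) ≤
      1000 * dynamicBound 1 T G ε (fun t => ‖ℓ t‖ ^ 2) u := by
  have hd0 : (1 : ℝ) ≤ d := by exact_mod_cast hd
  have hb : ∀ {g : ℕ → EuclideanSpace ℝ (Fin d)}, (∀ t < T, ‖g t‖ ≤ 3 * d * ‖ℓ t‖) →
      ∀ t < T, ‖g t‖ ≤ 3 * d * G := fun hg t ht =>
    (hg t ht).trans (mul_le_mul_of_nonneg_left (hℓ t ht) (by positivity))
  have hM0 : 0 ≤ maxNorm T u := maxNorm_nonneg T u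
  have hQ0 : 0 ≤ pathCost T ε u := pathCost_nonneg hT hε u
  have hdG : 0 < d * G := by positivity
  rw [dynamicBound_eq, div_one]
  set X := ∑ t ∈ Finset.range T, ‖ℓ t‖ ^ 2 * ‖u t‖ with hX
  have hsq : 0 ≤ d * √(pathCost T ε u * X) := by positivity
  have h7 := mul_nonneg hdG.le hM0
  have h8 := mul_nonneg hdG.le hQ0
  have h9 := mul_pos hdG hε
  by_cases hu : IsNegligible T ε u
  · have h1 := regret_zero_le hd hT hG hε (hb he)
    have h2 := regret_zero_le hd hT hG hε (hb he')
    have h3 := neg_sum_inner_le_of_isNegligible hG hℓ hu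
    nlinarith
  · have hX0 : 0 ≤ X := Finset.sum_nonneg fun t _ => by positivity
    have hXM : X ≤ G ^ 2 * T * maxNorm T u := sum_mul_norm_le (fun t ht =>
      ⟨by positivity, pow_le_pow_left₀ (norm_nonneg _) (hℓ t ht) 2⟩) u
    have hreg : ∀ {g : ℕ → EuclideanSpace ℝ (Fin d)}, (∀ t < T, ‖g t‖ ≤ 3 * d * ‖ℓ t‖) →
        ∑ t ∈ Finset.range T, inner ℝ (g t)
          (dynamicMetaOLO T (3 * d * G) (ε / d) (lossHistory g t)) -
          ∑ t ∈ Finset.range T, inner ℝ (g t) (u t) ≤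
        60 * (d * √(pathCost T ε u * X))
          + 460 * (d * G * (ε + maxNorm T u + pathCost T ε u)) := by
      intro g hg
      have h1 := regret_le_of_not_isNegligible hd hT hG hε (hb hg) hu
      have h2 : ∑ t ∈ Finset.range T, ‖g t‖ ^ 2 * ‖u t‖ ≤ (3 * d) ^ 2 * X := by
        rw [hX, Finset.mul_sum]
        refine Finset.sum_le_sum fun t ht => ?_
        rw [← mul_assoc, ← mul_pow]
        gcongr
        exact hg t (Finset.mem_range.1 ht)
      have h3 : √((pathCost T ε u + ε / T) * ∑ t ∈ Finset.range T, ‖g t‖ ^ 2 * ‖u t‖) ≤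
          3 * d * √((pathCost T ε u + ε / T) * X) := by
        rw [← Real.sqrt_sq (by positivity : (0 : ℝ) ≤ 3 * d), ← Real.sqrt_mul (by positivity)]
        apply Real.sqrt_le_sqrt
        calc _ ≤ (pathCost T ε u + ε / T) * ((3 * d) ^ 2 * X) := by gcongr
          _ = _ := by ring
      have h4 := sqrt_add_mul_le hT hG hε hQ0 hM0 hX0 hXM
      have h5 := mul_le_mul_of_nonneg_left h4 (by positivity : (0 : ℝ) ≤ 3 * d)
      simp only [inner_sub_right, Finset.sum_sub_distrib] at h1
      nlinarith
    have h1 := hreg he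
    have h2 := hreg he'
    simp only [inner_sub_left, Finset.sum_sub_distrib] at h2 ⊢
    nlinarith

/-- Against a fixed comparator sequence a single learner suffices, provided that the estimation
errors are integrated out; a negligible comparator is replaced by `0` there. -/
theorem oblivious_pathwise_le (hd : 1 ≤ d) {T : ℕ} (hT : 1 ≤ T) {G ε : ℝ} (hG : 0 < G)
    (hε : 0 < ε) {ℓ e : ℕ → EuclideanSpace ℝ (Fin d)} (hℓ : ∀ t < T, ‖ℓ t‖ ≤ G)
    (he : ∀ t < T, ‖e t‖ ≤ 3 * d * ‖ℓ t‖) (u û : ℕ → EuclideanSpace ℝ (Fin d))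
    (hû : IsNegligible T ε u → û = 0) (hû' : ¬IsNegligible T ε u → û = u) :
    ∑ t ∈ Finset.range T, inner ℝ (e t)
        (dynamicMetaOLO T (3 * d * G) (ε / d) (lossHistory e t)) -
      ∑ t ∈ Finset.range T, inner ℝ (ℓ t) (u t) -
      ∑ t ∈ Finset.range T, inner ℝ (e t - ℓ t) (û t) ≤
      20 * √((pathCost T ε u + ε / T) * ∑ t ∈ Finset.range T, ‖e t‖ ^ 2 * ‖u t‖)
        + 400 * (d * G * (ε + maxNorm T u + pathCost T ε u)) := by
  have hd0 : (1 : ℝ) ≤ d := by exact_mod_cast hd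
  have hb : ∀ t < T, ‖e t‖ ≤ 3 * d * G := fun t ht =>
    (he t ht).trans (mul_le_mul_of_nonneg_left (hℓ t ht) (by positivity))
  by_cases hu : IsNegligible T ε u
  · have h1 := regret_zero_le hd hT hG hε hb
    have h3 := neg_sum_inner_le_of_isNegligible hG hℓ hu
    have hdG : 0 < d * G := by positivity
    have h7 := mul_nonneg hdG.le (maxNorm_nonneg T u)
    have h8 := mul_nonneg hdG.le (pathCost_nonneg hT hε u)
    have h9 := mul_pos hdG hε
    have h10 := Real.sqrt_nonneg
      ((pathCost T ε u + ε / T) * ∑ t ∈ Finset.range T, ‖e t‖ ^ 2 * ‖u t‖)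
    rw [hû hu]
    simp only [Pi.zero_apply, inner_zero_right, Finset.sum_const_zero]
    nlinarith
  · have h1 := regret_le_of_not_isNegligible hd hT hG hε hb hu
    rw [hû' hu]
    simp only [inner_sub_right, inner_sub_left, Finset.sum_sub_distrib] at h1 ⊢
    linarith

end Pathwise

/-! ### Sampling a direction independently of the past -/

section Sampling

variable {d : ℕ}

theorem signedBasis_eq_range (v : OrthonormalBasis (Fin d) ℝ (EuclideanSpace ℝ (Fin d))) :
    signedBasis v = Set.range fun p : Fin d × Bool => if p.2 then v p.1 else -v p.1 := by
  ext x
  constructor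
  · rintro ⟨i, rfl | rfl⟩
    · exact ⟨(i, true), by simp⟩
    · exact ⟨(i, false), by simp⟩
  · rintro ⟨⟨i, b⟩, rfl⟩
    cases b
    · exact ⟨i, Or.inr (by simp)⟩
    · exact ⟨i, Or.inl (by simp)⟩

theorem injective_signed (v : OrthonormalBasis (Fin d) ℝ (EuclideanSpace ℝ (Fin d))) :
    Function.Injective fun p : Fin d × Bool => if p.2 then v p.1 else -v p.1 := by
  have key : ∀ i j : Fin d, v i ≠ -v j := by
    intro i j h
    have h1 : inner ℝ (v i) (v i) = (1 : ℝ) := by simp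
    have h2 : inner ℝ (v i) (v j) = (if i = j then 1 else 0 : ℝ) := by
      rw [orthonormal_iff_ite.1 v.orthonormal]
    nth_rewrite 2 [h] at h1
    rw [inner_neg_right, h2] at h1
    split_ifs at h1 <;> norm_num at h1
  have hinj : Function.Injective v := v.orthonormal.linearIndependent.injective
  rintro ⟨i, b⟩ ⟨j, c⟩ h
  cases b <;> cases c <;> simp only [if_true, Bool.false_eq_true, if_false] at h
  · rw [hinj (neg_injective h)]
  · exact absurd h.symm (key _ _)
  · exact absurd h (key _ _)
  · rw [hinj h]

theorem ae_mem_signedBasis {v : OrthonormalBasis (Fin d) ℝ (EuclideanSpace ℝ (Fin d))}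
    {Ω : Type*} {mΩ : MeasurableSpace Ω} {μ : Measure Ω} {s : Ω → EuclideanSpace ℝ (Fin d)}
    (hs : Measurable s) (hlaw : μ.map s = uniformOn (signedBasis v)) :
    ∀ᵐ ω ∂μ, s ω ∈ signedBasis v := by
  have hfin : (signedBasis v).Finite := by
    rw [signedBasis_eq_range]
    exact Set.finite_range _
  refine ae_of_ae_map hs.aemeasurable ?_
  rw [hlaw]
  exact ae_cond_mem hfin.measurableSet

theorem setIntegral_eq_measureReal_mul_of_indep {Ω : Type*} {m m' mΩ : MeasurableSpace Ω}
    {μ : Measure Ω} [IsProbabilityMeasure μ] (hm : m ≤ mΩ) (hm' : m' ≤ mΩ) (hind : Indep m' m μ)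
    {Y : Ω → ℝ} (hY : Measurable[m] Y) (hYi : Integrable Y μ) {A : Set Ω}
    (hA : MeasurableSet[m'] A) : ∫ ω in A, Y ω ∂μ = μ.real A * ∫ ω, Y ω ∂μ := by
  rw [← setIntegral_condExp hm' hYi hA,
    setIntegral_congr_ae (g := fun _ => ∫ ω, Y ω ∂μ) (hm' _ hA)
      ((condExp_indep_eq hm hm' hY.stronglyMeasurable hind.symm).mono fun _ h _ => h),
    setIntegral_const, smul_eq_mul]

/-- Averaging over a direction that is uniform on `{± v_i}` and independent of the past. -/
theorem integral_sampled {Ω : Type*} {m mΩ : MeasurableSpace Ω} {μ : Measure Ω}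
    [IsProbabilityMeasure μ] (hm : m ≤ mΩ) (hd : 1 ≤ d)
    (v : OrthonormalBasis (Fin d) ℝ (EuclideanSpace ℝ (Fin d)))
    {s : Ω → EuclideanSpace ℝ (Fin d)} (hs : Measurable s)
    (hlaw : μ.map s = uniformOn (signedBasis v))
    (hind : Indep (MeasurableSpace.comap s inferInstance) m μ)
    {Y : EuclideanSpace ℝ (Fin d) → Ω → ℝ} (hY : ∀ x ∈ signedBasis v, Measurable[m] (Y x))
    (hYi : ∀ x ∈ signedBasis v, Integrable (Y x) μ) :
    Integrable (fun ω => Y (s ω) ω) μ ∧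
      2 * d * ∫ ω, Y (s ω) ω ∂μ = ∫ ω, ∑ i, (Y (v i) ω + Y (-v i) ω) ∂μ := by
  classical
  have hd0 : (d : ℝ) ≠ 0 := by exact_mod_cast (by omega : d ≠ 0)
  set f : Fin d × Bool → EuclideanSpace ℝ (Fin d) := fun p => if p.2 then v p.1 else -v p.1
  have hf : Function.Injective f := injective_signed v
  have hmem : ∀ p, f p ∈ signedBasis v := fun p => by
    rw [signedBasis_eq_range]; exact ⟨p, rfl⟩
  set F : Finset (EuclideanSpace ℝ (Fin d)) := Finset.univ.image f with hF
  have hFS : (F : Set (EuclideanSpace ℝ (Fin d))) = signedBasis v := by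
    rw [signedBasis_eq_range, hF, Finset.coe_image, Finset.coe_univ, Set.image_univ]
  have hcard : F.card = 2 * d := by
    rw [hF, Finset.card_image_of_injective _ hf]
    simp [mul_comm]
  have hprob : ∀ p, μ.real (s ⁻¹' {f p}) = (2 * d : ℝ)⁻¹ := by
    intro p
    have h1 : F ∩ {f p} = {f p} := by
      rw [Finset.inter_singleton_of_mem]
      exact Finset.mem_image_of_mem _ (Finset.mem_univ p)
    have h2 := uniformOn_apply_finset (s := F) (t := {f p})
    rw [hFS, h1, ← hlaw, Finset.coe_singleton, Measure.map_apply hs (measurableSet_singleton _),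
      hcard] at h2
    rw [measureReal_def, h2]
    simp
  have hsupp := ae_mem_signedBasis hs hlaw
  have hae : (fun ω => Y (s ω) ω) =ᵐ[μ]
      fun ω => ∑ p, (s ⁻¹' {f p}).indicator (Y (f p)) ω := by
    filter_upwards [hsupp] with ω hω
    rw [signedBasis_eq_range] at hω
    obtain ⟨p, hp⟩ := hω
    have hp : f p = s ω := hp
    rw [Finset.sum_eq_single p]
    · rw [Set.indicator_of_mem (by simp [hp]), hp]
    · intro q _ hq
      refine Set.indicator_of_notMem ?_ _
      simp only [Set.mem_preimage, Set.mem_singleton_iff, ← hp]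
      exact fun h => hq (hf h).symm
    · simp
  have hset : ∀ p, MeasurableSet[MeasurableSpace.comap s inferInstance] (s ⁻¹' {f p}) :=
    fun p => ⟨_, measurableSet_singleton _, rfl⟩
  have hint : ∀ p, Integrable ((s ⁻¹' {f p}).indicator (Y (f p))) μ := fun p =>
    (hYi _ (hmem p)).indicator (hs.comap_le _ (hset p))
  refine ⟨(integrable_finsetSum _ fun p _ => hint p).congr hae.symm, ?_⟩
  rw [integral_congr_ae hae, integral_finsetSum _ fun p _ => hint p]
  have h1 : ∀ p, ∫ ω, (s ⁻¹' {f p}).indicator (Y (f p)) ω ∂μ =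
      (2 * d : ℝ)⁻¹ * ∫ ω, Y (f p) ω ∂μ := by
    intro p
    rw [integral_indicator (hs.comap_le _ (hset p)),
      setIntegral_eq_measureReal_mul_of_indep hm hs.comap_le hind (hY _ (hmem p))
        (hYi _ (hmem p)) (hset p), hprob]
  rw [Finset.sum_congr rfl fun p _ => h1 p, ← Finset.mul_sum, ← mul_assoc,
    mul_inv_cancel₀ (by positivity), one_mul, Fintype.sum_prod_type,
    integral_finsetSum (f := fun i ω => Y (v i) ω + Y (-v i) ω) _
      fun i _ => (hYi _ ⟨i, Or.inl rfl⟩).add (hYi _ ⟨i, Or.inr rfl⟩)]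
  refine Finset.sum_congr rfl fun i _ => ?_
  rw [integral_add (hYi _ ⟨i, Or.inl rfl⟩) (hYi _ ⟨i, Or.inr rfl⟩)]
  simp [f]

end Sampling

/-! ### Measurability of the algorithm -/

section Measurability

variable {d : ℕ} {Ω : Type*} [MeasurableSpace Ω]

theorem measurable_dynamicMetaOLO (T : ℕ) (L ε : ℝ) {g : ℕ → Ω → EuclideanSpace ℝ (Fin d)}
    {t : ℕ} (hg : ∀ i < t, Measurable (g i)) :
    Measurable fun ω => dynamicMetaOLO T L ε (lossHistory (fun i => g i ω) t) := by
  refine Finset.measurable_sum _ fun η _ => ?_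
  induction t with
  | zero => exact measurable_const
  | succ t ih =>
    have h1 := ih fun i hi => hg i (by omega)
    have h2 := hg t (by omega)
    simp only [lossHistory, dynamicBaseOLO, baseStep]
    fun_prop

theorem measurable_perturbScale {w : Ω → EuclideanSpace ℝ (Fin d)} (ϱ : ℝ) (hw : Measurable w) :
    Measurable fun ω => perturbScale ϱ (w ω) := by
  unfold perturbScale
  fun_prop

theorem measurable_roundEstimate (ϱ : ℝ) {w l s : Ω → EuclideanSpace ℝ (Fin d)}
    (hw : Measurable w) (hl : Measurable l) (hs : Measurable s) :
    Measurable fun ω => roundEstimate ϱ (w ω) (l ω) (s ω) := by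
  have := measurable_perturbScale ϱ hw
  unfold roundEstimate lossEstimate perturbedAction
  fun_prop

theorem measurable_inner_roundEstimate_sub (ϱ : ℝ) {w l y : Ω → EuclideanSpace ℝ (Fin d)}
    (hw : Measurable w) (hl : Measurable l) (hy : Measurable y) (x : EuclideanSpace ℝ (Fin d)) :
    Measurable fun ω => (inner ℝ (roundEstimate ϱ (w ω) (l ω) x - l ω) (y ω) : ℝ) :=
  ((measurable_roundEstimate ϱ hw hl measurable_const).sub hl).inner hy

theorem measurable_inner_exploration (ϱ : ℝ) {w l : Ω → EuclideanSpace ℝ (Fin d)}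
    (hw : Measurable w) (hl : Measurable l) (x : EuclideanSpace ℝ (Fin d)) :
    Measurable fun ω => (inner ℝ (l ω) ((√(perturbScale ϱ (w ω)))⁻¹ • x) : ℝ) := by
  have := measurable_perturbScale ϱ hw
  fun_prop

theorem measurable_mul_norm_sq {c : Ω → ℝ} {f : Ω → EuclideanSpace ℝ (Fin d)}
    (hc : Measurable c) (hf : Measurable f) : Measurable fun ω => c ω * ‖f ω‖ ^ 2 :=
  hc.mul (hf.norm.pow_const 2)

theorem measurable_maxNorm {T : ℕ} {u : ℕ → Ω → EuclideanSpace ℝ (Fin d)}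
    (hu : ∀ t < T, Measurable (u t)) : Measurable fun ω => maxNorm T fun t => u t ω :=
  Measurable.iSup fun t => (hu t t.2).norm

theorem measurable_pathCost {T : ℕ} (hT : 1 ≤ T) (ε : ℝ)
    {u : ℕ → Ω → EuclideanSpace ℝ (Fin d)} (hu : ∀ t < T, Measurable (u t)) :
    Measurable fun ω => pathCost T ε fun t => u t ω := by
  unfold pathCost phiLast phiPathLength
  have h1 := hu (T - 1) (by omega)
  refine Measurable.add (by fun_prop) (Finset.measurable_sum _ fun t ht => ?_)
  have ht := Finset.mem_range.1 ht
  have h2 := hu t (by omega)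
  have h3 := hu (t + 1) (by omega)
  fun_prop

theorem exists_norm_dynamicMetaOLO_le {T : ℕ} (hT : 1 ≤ T) {L ε : ℝ} (hL : 0 < L) (hε : 0 < ε)
    (n : ℕ) : ∃ K : ℝ, ∀ g : ℕ → EuclideanSpace ℝ (Fin d), (∀ t < n, ‖g t‖ ≤ L) →
      ‖dynamicMetaOLO T L ε (lossHistory g n)‖ ≤ K := by
  have hT0 : (0 : ℝ) < T := by exact_mod_cast hT
  refine ⟨∑ η ∈ stepSizes T L, ε / T * Real.exp (η / 4 * (n * L)), fun g hg => ?_⟩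
  refine (norm_sum_le _ _).trans (Finset.sum_le_sum fun η hη => ?_)
  exact norm_baseIterate_le (w := fun t => dynamicBaseOLO 4 (ε / T) (L / T) η (lossHistory g t))
    (by positivity) (stepSizes_bounds hT hL hη).1 (by positivity) rfl (fun _ => rfl) n hg

end Measurability

/-! ### The stochastic process of losses, directions and estimates -/

/-- The assumptions on the losses and on the sampled directions: the losses are predictable and
bounded by `G`, and the directions are uniform on `{± v_i}` and independent of the history. -/
structure IsBanditProcess {d : ℕ} {Ω : Type*} {mΩ : MeasurableSpace Ω} (T : ℕ) (G : ℝ)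
    (v : ℕ → OrthonormalBasis (Fin d) ℝ (EuclideanSpace ℝ (Fin d))) (μ : Measure Ω)
    (𝓕 : Filtration ℕ mΩ) (ℓ s : ℕ → Ω → EuclideanSpace ℝ (Fin d)) : Prop where
  measurable_loss : ∀ t < T, Measurable[𝓕 t] (ℓ t)
  norm_loss_le : ∀ t < T, ∀ᵐ ω ∂μ, ‖ℓ t ω‖ ≤ G
  measurable_dir : ∀ t < T, Measurable[𝓕 (t + 1)] (s t)
  law_dir : ∀ t < T, μ.map (s t) = uniformOn (signedBasis (v t))
  indep_dir : ∀ t < T, Indep (MeasurableSpace.comap (s t) inferInstance) (𝓕 t) μ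

namespace IsBanditProcess

variable {d T : ℕ} {G ϱ : ℝ} {v : ℕ → OrthonormalBasis (Fin d) ℝ (EuclideanSpace ℝ (Fin d))}
  {Ω : Type*} {mΩ : MeasurableSpace Ω} {μ : Measure Ω} [IsProbabilityMeasure μ]
  {𝓕 : Filtration ℕ mΩ} {ℓ s : ℕ → Ω → EuclideanSpace ℝ (Fin d)}

omit [IsProbabilityMeasure μ] in
theorem measurable_estimate_and_action (h : IsBanditProcess T G v μ 𝓕 ℓ s) (ϱ L ε : ℝ) {t : ℕ}
    (ht : t ≤ T) :
    (∀ i < t, Measurable[𝓕 (i + 1)] fun ω =>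
      pabloEstimate (dynamicMetaOLO T L ε) ϱ (fun i => ℓ i ω) (fun i => s i ω) i) ∧
    Measurable[𝓕 t] fun ω => dynamicMetaOLO T L ε
      (pabloHistory (dynamicMetaOLO T L ε) ϱ (fun i => ℓ i ω) (fun i => s i ω) t) := by
  have key : ∀ {t : ℕ}, (∀ i < t, Measurable[𝓕 (i + 1)] fun ω =>
      pabloEstimate (dynamicMetaOLO T L ε) ϱ (fun i => ℓ i ω) (fun i => s i ω) i) →
      Measurable[𝓕 t] fun ω => dynamicMetaOLO T L ε
        (pabloHistory (dynamicMetaOLO T L ε) ϱ (fun i => ℓ i ω) (fun i => s i ω) t) := by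
    intro t hest
    simp only [pabloHistory_eq_lossHistory]
    exact @measurable_dynamicMetaOLO d Ω (𝓕 t) T L ε
      (fun i ω => pabloEstimate (dynamicMetaOLO T L ε) ϱ (fun i => ℓ i ω) (fun i => s i ω) i) t
      fun i hi => (hest i hi).mono (𝓕.mono (by omega)) le_rfl
  suffices hest : ∀ i < t, Measurable[𝓕 (i + 1)] fun ω =>
      pabloEstimate (dynamicMetaOLO T L ε) ϱ (fun i => ℓ i ω) (fun i => s i ω) i from
    ⟨hest, key hest⟩
  induction t with
  | zero => intro i hi; omega
  | succ t ih =>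
    intro i hi
    have ih := ih (by omega)
    rcases (Nat.lt_succ_iff_lt_or_eq.1 hi) with h1 | rfl
    · exact ih i h1
    · exact @measurable_roundEstimate d Ω (𝓕 (i + 1)) ϱ _ _ _
        ((key ih).mono (𝓕.mono (by omega)) le_rfl)
        ((h.measurable_loss i (by omega)).mono (𝓕.mono (by omega)) le_rfl)
        (h.measurable_dir i (by omega))

omit [IsProbabilityMeasure μ] in
theorem ae_bounds (h : IsBanditProcess T G v μ 𝓕 ℓ s) :
    ∀ᵐ ω ∂μ, ∀ t < T, ‖ℓ t ω‖ ≤ G ∧ ‖s t ω‖ = 1 := by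
  refine ae_all_iff.2 fun t => ?_
  by_cases ht : t < T
  · filter_upwards [h.norm_loss_le t ht, ae_mem_signedBasis
      ((h.measurable_dir t ht).mono (𝓕.le _) le_rfl) (h.law_dir t ht)] with ω h1 h2 _
    exact ⟨h1, norm_eq_one_of_mem_signedBasis h2⟩
  · exact Filter.Eventually.of_forall fun ω h => absurd h ht

/-- Averaging over the direction of round `t`. -/
theorem integral_dir (h : IsBanditProcess T G v μ 𝓕 ℓ s) (hd : 1 ≤ d) {t : ℕ} (ht : t < T)
    {Y : EuclideanSpace ℝ (Fin d) → Ω → ℝ}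
    (hY : ∀ x ∈ signedBasis (v t), Measurable[𝓕 t] (Y x))
    (hYi : ∀ x ∈ signedBasis (v t), Integrable (Y x) μ) :
    Integrable (fun ω => Y (s t ω) ω) μ ∧
      2 * d * ∫ ω, Y (s t ω) ω ∂μ = ∫ ω, ∑ i, (Y (v t i) ω + Y (-v t i) ω) ∂μ :=
  integral_sampled (𝓕.le t) hd (v t) ((h.measurable_dir t ht).mono (𝓕.le _) le_rfl)
    (h.law_dir t ht) (h.indep_dir t ht) hY hYi

/-- The estimation error is orthogonal in mean to everything known before the round. -/
theorem integral_inner_estimate_sub (h : IsBanditProcess T G v μ 𝓕 ℓ s) (hd : 1 ≤ d)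
    (hϱ : 0 < ϱ) {t : ℕ} (ht : t < T) {w y : Ω → EuclideanSpace ℝ (Fin d)}
    (hw : Measurable[𝓕 t] w) (hy : Measurable[𝓕 t] y) (hyi : Integrable y μ) :
    Integrable (fun ω => inner ℝ (roundEstimate ϱ (w ω) (ℓ t ω) (s t ω) - ℓ t ω) (y ω)) μ ∧
      ∫ ω, inner ℝ (roundEstimate ϱ (w ω) (ℓ t ω) (s t ω) - ℓ t ω) (y ω) ∂μ = 0 := by
  have hd0 : (d : ℝ) ≠ 0 := by exact_mod_cast (by omega : d ≠ 0)
  have hmeas : ∀ x : EuclideanSpace ℝ (Fin d), Measurable[𝓕 t] fun ω =>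
      (inner ℝ (roundEstimate ϱ (w ω) (ℓ t ω) x - ℓ t ω) (y ω) : ℝ) := fun x =>
    @measurable_inner_roundEstimate_sub d Ω (𝓕 t) ϱ _ _ _ hw (h.measurable_loss t ht) hy x
  have key := h.integral_dir hd ht
    (Y := fun x ω => inner ℝ (roundEstimate ϱ (w ω) (ℓ t ω) x - ℓ t ω) (y ω))
    (fun x _ => hmeas x) fun x hx => by
      refine Integrable.mono' (hyi.norm.const_mul (3 * d * G))
        ((hmeas x).mono (𝓕.le t) le_rfl).aestronglyMeasurable ?_
      filter_upwards [h.norm_loss_le t ht] with ω hω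
      refine (norm_inner_le_norm _ _).trans ?_
      refine mul_le_mul_of_nonneg_right ?_ (norm_nonneg _)
      rw [norm_sub_rev]
      exact (norm_sub_roundEstimate_le hd hϱ (norm_eq_one_of_mem_signedBasis hx)).trans
        (mul_le_mul_of_nonneg_left hω (by positivity))
  refine ⟨key.1, ?_⟩
  have h2 := key.2
  simp only [sum_inner_roundEstimate hd hϱ, integral_zero] at h2
  exact (mul_eq_zero.1 h2).resolve_left (by positivity)

/-- The exploration part of the action does not contribute to the expected loss. -/
theorem integral_inner_exploration (h : IsBanditProcess T G v μ 𝓕 ℓ s) (hd : 1 ≤ d)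
    (hϱ : 0 < ϱ) {t : ℕ} (ht : t < T) {w : Ω → EuclideanSpace ℝ (Fin d)}
    (hw : Measurable[𝓕 t] w) {K : ℝ} (hK : ∀ᵐ ω ∂μ, ‖w ω‖ ≤ K) :
    Integrable (fun ω => inner ℝ (ℓ t ω) ((√(perturbScale ϱ (w ω)))⁻¹ • s t ω)) μ ∧
      ∫ ω, inner ℝ (ℓ t ω) ((√(perturbScale ϱ (w ω)))⁻¹ • s t ω) ∂μ = 0 := by
  have hd0 : (d : ℝ) ≠ 0 := by exact_mod_cast (by omega : d ≠ 0)
  have hmeas : ∀ x : EuclideanSpace ℝ (Fin d), Measurable[𝓕 t] fun ω =>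
      (inner ℝ (ℓ t ω) ((√(perturbScale ϱ (w ω)))⁻¹ • x) : ℝ) := fun x =>
    @measurable_inner_exploration d Ω (𝓕 t) ϱ _ _ hw (h.measurable_loss t ht) x
  have key := h.integral_dir hd ht
    (Y := fun x ω => inner ℝ (ℓ t ω) ((√(perturbScale ϱ (w ω)))⁻¹ • x))
    (fun x _ => hmeas x) fun x hx => by
      refine Integrable.mono' (integrable_const (G * (√d * (K + ϱ))))
        ((hmeas x).mono (𝓕.le t) le_rfl).aestronglyMeasurable ?_
      filter_upwards [h.norm_loss_le t ht, hK] with ω hω hwω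
      refine (norm_inner_le_norm _ _).trans ?_
      rw [norm_smul, norm_eq_one_of_mem_signedBasis hx, mul_one,
        Real.norm_of_nonneg (by positivity)]
      refine mul_le_mul hω ((inv_sqrt_perturbScale_le hϱ _).trans ?_) (by positivity)
        ((norm_nonneg _).trans hω)
      gcongr
  refine ⟨key.1, ?_⟩
  have h2 := key.2
  simp only [smul_neg, inner_neg_right, add_neg_cancel, Finset.sum_const_zero,
    integral_zero] at h2
  exact (mul_eq_zero.1 h2).resolve_left (by positivity)

/-- Conditional second moment of the estimate, tested against a weight known before the round. -/
theorem integral_mul_norm_sq_estimate_le (h : IsBanditProcess T G v μ 𝓕 ℓ s) (hd : 1 ≤ d)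
    (hϱ : 0 < ϱ) {t : ℕ} (ht : t < T) {w : Ω → EuclideanSpace ℝ (Fin d)} {c : Ω → ℝ}
    (hw : Measurable[𝓕 t] w) (hc : Measurable[𝓕 t] c) (hc0 : ∀ ω, 0 ≤ c ω)
    (hci : Integrable c μ) :
    Integrable (fun ω => c ω * ‖roundEstimate ϱ (w ω) (ℓ t ω) (s t ω)‖ ^ 2) μ ∧
      ∫ ω, c ω * ‖roundEstimate ϱ (w ω) (ℓ t ω) (s t ω)‖ ^ 2 ∂μ ≤
        2 * d * ∫ ω, c ω * ‖ℓ t ω‖ ^ 2 ∂μ := by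
  have hd0 : (0 : ℝ) < d := by exact_mod_cast hd
  have hmeas : ∀ x : EuclideanSpace ℝ (Fin d), Measurable[𝓕 t] fun ω =>
      c ω * ‖roundEstimate ϱ (w ω) (ℓ t ω) x‖ ^ 2 := fun x =>
    @measurable_mul_norm_sq d Ω (𝓕 t) _ _ hc
      (@measurable_roundEstimate d Ω (𝓕 t) ϱ _ _ _ hw (h.measurable_loss t ht) measurable_const)
  have hYi : ∀ x ∈ signedBasis (v t), Integrable
      (fun ω => c ω * ‖roundEstimate ϱ (w ω) (ℓ t ω) x‖ ^ 2) μ := fun x hx => by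
    refine Integrable.mono' (hci.mul_const ((2 * d * G) ^ 2))
      ((hmeas x).mono (𝓕.le t) le_rfl).aestronglyMeasurable ?_
    filter_upwards [h.norm_loss_le t ht] with ω hω
    rw [Real.norm_of_nonneg (mul_nonneg (hc0 ω) (by positivity))]
    refine mul_le_mul_of_nonneg_left (pow_le_pow_left₀ (norm_nonneg _) ?_ 2) (hc0 ω)
    exact (norm_roundEstimate_le hd hϱ (norm_eq_one_of_mem_signedBasis hx)).trans
      (mul_le_mul_of_nonneg_left hω (by positivity))
  have hloss : Integrable (fun ω => c ω * ‖ℓ t ω‖ ^ 2) μ := by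
    refine Integrable.mono' (hci.mul_const (G ^ 2))
      ((@measurable_mul_norm_sq d Ω (𝓕 t) _ _ hc (h.measurable_loss t ht)).mono
        (𝓕.le t) le_rfl).aestronglyMeasurable ?_
    filter_upwards [h.norm_loss_le t ht] with ω hω
    rw [Real.norm_of_nonneg (mul_nonneg (hc0 ω) (by positivity))]
    exact mul_le_mul_of_nonneg_left (pow_le_pow_left₀ (norm_nonneg _) hω 2) (hc0 ω)
  have key := h.integral_dir hd ht
    (Y := fun x ω => c ω * ‖roundEstimate ϱ (w ω) (ℓ t ω) x‖ ^ 2) (fun x _ => hmeas x) hYi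
  refine ⟨key.1, ?_⟩
  have h1 : ∫ ω, ∑ i, (c ω * ‖roundEstimate ϱ (w ω) (ℓ t ω) (v t i)‖ ^ 2 +
      c ω * ‖roundEstimate ϱ (w ω) (ℓ t ω) (-v t i)‖ ^ 2) ∂μ ≤
      ∫ ω, 2 * d * (2 * d) * (c ω * ‖ℓ t ω‖ ^ 2) ∂μ := by
    refine integral_mono (integrable_finsetSum _ fun i _ =>
      (hYi _ ⟨i, Or.inl rfl⟩).add (hYi _ ⟨i, Or.inr rfl⟩)) (hloss.const_mul _) fun ω => ?_
    have h2 := mul_le_mul_of_nonneg_left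
      (sum_norm_sq_roundEstimate_le hd hϱ (v t) (w ω) (ℓ t ω)) (hc0 ω)
    simp only [← mul_add, ← Finset.mul_sum]
    linarith
  rw [← key.2, integral_const_mul, mul_assoc (2 * (d : ℝ))] at h1
  exact le_of_mul_le_mul_left h1 (by positivity)

end IsBanditProcess

/-! ### Expected regret -/

section Balance

/-- A square root linearized around the predictable quantity `Y`. -/
theorem sqrt_mul_le_half_add {A Y S : ℝ} (hA : 0 ≤ A) (hY : 0 ≤ Y) (hS : 0 ≤ S)
    (h : Y = 0 → S = 0) : √(A * S) ≤ (√(A * Y) + √(A / Y) * S) / 2 := by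
  rcases hY.eq_or_lt with h0 | h0
  · rw [h h0.symm, mul_zero, mul_zero, Real.sqrt_zero]
    positivity
  · have e : A * S = √(A * Y) * (√(A / Y) * S) := by
      rw [← mul_assoc, ← Real.sqrt_mul (by positivity),
        show A * Y * (A / Y) = A ^ 2 by field_simp, Real.sqrt_sq hA]
    rw [e, Real.sqrt_le_left (by positivity)]
    nlinarith [sq_nonneg (√(A * Y) - √(A / Y) * S)]

theorem sqrt_div_mul_self_eq {A Y : ℝ} (hY : 0 ≤ Y) : √(A / Y) * Y = √(A * Y) := by
  rcases hY.eq_or_lt with h0 | h0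
  · simp [← h0]
  · nth_rewrite 2 [← Real.sqrt_sq hY]
    rw [← Real.sqrt_mul' _ (by positivity), show A / Y * Y ^ 2 = A * Y by field_simp]

theorem sqrt_div_mul_le {A Y M G x : ℝ} (hA : 0 ≤ A) (hG : 0 < G) (hx : 0 ≤ x) (hxM : x ≤ M)
    (hY : G ^ 2 * M ≤ Y) : √(A / Y) * x ≤ (A + M) / G := by
  have hM : 0 ≤ M := hx.trans hxM
  rcases hM.eq_or_lt with h0 | h0
  · rw [le_antisymm (hxM.trans h0.symm.le) hx, mul_zero]
    positivity
  · have hY0 : 0 < Y := lt_of_lt_of_le (by positivity) hY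
    calc √(A / Y) * x ≤ √(A / (G ^ 2 * M)) * M := by gcongr
      _ = √(A * M / G ^ 2) := by
        nth_rewrite 2 [← Real.sqrt_sq hM]
        rw [← Real.sqrt_mul' _ (by positivity)]
        congr 1
        field_simp
      _ ≤ (A + M) / G := by
        rw [Real.sqrt_le_left (by positivity), div_pow]
        gcongr
        nlinarith

end Balance

section Comparator

variable {d T : ℕ} {Ω : Type*}

theorem mul_add_le_dynamicBound {κ G ε : ℝ} (hκ : 0 ≤ κ) (q : ℕ → ℝ)
    (u : ℕ → EuclideanSpace ℝ (Fin d)) :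
    d * G * (ε + maxNorm T u + pathCost T ε u) ≤ dynamicBound κ T G ε q u := by
  rw [dynamicBound_eq]
  have : 0 ≤ d / κ * √(pathCost T ε u * ∑ t ∈ Finset.range T, q t * ‖u t‖) := by positivity
  linarith

theorem integrable_comparator {mΩ : MeasurableSpace Ω} {μ : Measure Ω} (hd : 1 ≤ d) (hT : 1 ≤ T)
    {κ G ε : ℝ} (hκ : 0 ≤ κ) (hG : 0 < G) (hε : 0 < ε) {q : ℕ → Ω → ℝ}
    {u : ℕ → Ω → EuclideanSpace ℝ (Fin d)} (hu : ∀ t < T, Measurable (u t))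
    (hB : Integrable (fun ω => dynamicBound κ T G ε (fun t => q t ω) fun t => u t ω) μ) :
    Integrable (fun ω => maxNorm T fun t => u t ω) μ ∧
      Integrable (fun ω => pathCost T ε fun t => u t ω) μ ∧ ∀ t < T, Integrable (u t) μ := by
  have hdG : 0 < d * G := by
    have : (0 : ℝ) < d := by exact_mod_cast hd
    positivity
  have hM : Integrable (fun ω => maxNorm T fun t => u t ω) μ := by
    refine Integrable.mono' (hB.const_mul (d * G)⁻¹)
      (measurable_maxNorm hu).aestronglyMeasurable (Filter.Eventually.of_forall fun ω => ?_)
    rw [Real.norm_of_nonneg (maxNorm_nonneg _ _), ← div_eq_inv_mul, le_div_iff₀ hdG]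
    have h1 := mul_add_le_dynamicBound (T := T) (G := G) (ε := ε) hκ (fun t => q t ω)
      fun t => u t ω
    have h2 := mul_nonneg hdG.le (pathCost_nonneg hT hε fun t => u t ω)
    have h3 := mul_pos hdG hε
    linarith
  refine ⟨hM, ?_, fun t ht => ?_⟩
  · refine Integrable.mono' (hB.const_mul (d * G)⁻¹)
      (measurable_pathCost hT ε hu).aestronglyMeasurable (Filter.Eventually.of_forall fun ω => ?_)
    rw [Real.norm_of_nonneg (pathCost_nonneg hT hε _), ← div_eq_inv_mul, le_div_iff₀ hdG]
    have h1 := mul_add_le_dynamicBound (T := T) (G := G) (ε := ε) hκ (fun t => q t ω)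
      fun t => u t ω
    have h2 := mul_nonneg hdG.le (maxNorm_nonneg T fun t => u t ω)
    have h3 := mul_pos hdG hε
    linarith
  · exact Integrable.mono' hM (hu t ht).aestronglyMeasurable
      (Filter.Eventually.of_forall fun ω => norm_le_maxNorm ht fun t => u t ω)

theorem measurable_vector_sub [MeasurableSpace Ω] {f g : Ω → EuclideanSpace ℝ (Fin d)}
    (hf : Measurable f) (hg : Measurable g) : Measurable fun ω => f ω - g ω :=
  hf.sub hg

theorem measurable_norm_sq [MeasurableSpace Ω] {f : Ω → EuclideanSpace ℝ (Fin d)}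
    (hf : Measurable f) : Measurable fun ω => ‖f ω‖ ^ 2 :=
  hf.norm.pow_const 2

theorem measurable_sum_mul_norm [MeasurableSpace Ω] {q : ℕ → Ω → ℝ}
    {u : ℕ → Ω → EuclideanSpace ℝ (Fin d)} (hq : ∀ t < T, Measurable (q t))
    (hu : ∀ t < T, Measurable (u t)) :
    Measurable fun ω => ∑ t ∈ Finset.range T, q t ω * ‖u t ω‖ :=
  Finset.measurable_sum _ fun t ht =>
    (hq t (Finset.mem_range.1 ht)).mul (hu t (Finset.mem_range.1 ht)).norm

theorem measurable_sqrt_div_mul_norm [MeasurableSpace Ω] {a b : Ω → ℝ}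
    {u : Ω → EuclideanSpace ℝ (Fin d)} (ha : Measurable a) (hb : Measurable b)
    (hu : Measurable u) : Measurable fun ω => √(a ω / b ω) * ‖u ω‖ :=
  (ha.div hb).sqrt.mul hu.norm

open Classical in
/-- The comparator sequence, replaced by `0` where it is negligible. -/
noncomputable def truncatedComparator (T : ℕ) (ε : ℝ) (u : ℕ → EuclideanSpace ℝ (Fin d)) :
    ℕ → EuclideanSpace ℝ (Fin d) :=
  if IsNegligible T ε u then 0 else u

theorem measurable_truncatedComparator [MeasurableSpace Ω] (ε : ℝ)
    {u : ℕ → Ω → EuclideanSpace ℝ (Fin d)} (hu : ∀ t < T, Measurable (u t)) {t : ℕ} (ht : t < T) :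
    Measurable fun ω => truncatedComparator T ε (fun t => u t ω) t := by
  classical
  have hset : MeasurableSet {ω | IsNegligible T ε fun t => u t ω} := by
    have := measurable_maxNorm hu
    exact measurableSet_le (by fun_prop) (by fun_prop)
  have e : (fun ω => truncatedComparator T ε (fun t => u t ω) t) =
      fun ω => if IsNegligible T ε (fun t => u t ω) then 0 else u t ω := by
    funext ω
    unfold truncatedComparator
    split_ifs <;> rfl
  rw [e]
  exact Measurable.ite hset measurable_const (hu t ht)

theorem norm_truncatedComparator_le (T : ℕ) (ε : ℝ) (u : ℕ → EuclideanSpace ℝ (Fin d)) (t : ℕ) :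
    ‖truncatedComparator T ε u t‖ ≤ ‖u t‖ := by
  unfold truncatedComparator
  split_ifs
  · simp
  · exact le_rfl

end Comparator

namespace IsBanditProcess

variable {d T : ℕ} {G ϱ ε : ℝ} {v : ℕ → OrthonormalBasis (Fin d) ℝ (EuclideanSpace ℝ (Fin d))}
  {Ω : Type*} {mΩ : MeasurableSpace Ω} {μ : Measure Ω} [IsProbabilityMeasure μ]
  {𝓕 : Filtration ℕ mΩ} {ℓ s : ℕ → Ω → EuclideanSpace ℝ (Fin d)}

/-- The contribution of round `t` to `regretNoise`. -/
noncomputable def noiseTerm (A : OLOLearner (EuclideanSpace ℝ (Fin d))) (ϱ : ℝ)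
    (ℓ s y : ℕ → EuclideanSpace ℝ (Fin d)) (t : ℕ) : ℝ :=
  inner ℝ (ℓ t) ((√(perturbScale ϱ (A (pabloHistory A ϱ ℓ s t))))⁻¹ • s t)
    - inner ℝ (pabloEstimate A ϱ ℓ s t - ℓ t) (A (pabloHistory A ϱ ℓ s t))
    + inner ℝ (pabloEstimate A ϱ ℓ s t - ℓ t) (y t)

/-- The martingale part of the regret, for a predictable sequence `y` that the estimation errors
are tested against: it has mean zero. -/
noncomputable def regretNoise (A : OLOLearner (EuclideanSpace ℝ (Fin d))) (ϱ : ℝ) (T : ℕ)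
    (ℓ s y : ℕ → EuclideanSpace ℝ (Fin d)) : ℝ :=
  ∑ t ∈ Finset.range T, noiseTerm A ϱ ℓ s y t

theorem pabloRegret_sub_regretNoise (A : OLOLearner (EuclideanSpace ℝ (Fin d))) (ϱ : ℝ) (T : ℕ)
    (ℓ s u y : ℕ → EuclideanSpace ℝ (Fin d)) :
    pabloRegret A ϱ T ℓ s u - regretNoise A ϱ T ℓ s y =
      ∑ t ∈ Finset.range T, inner ℝ (pabloEstimate A ϱ ℓ s t)
          (A (lossHistory (pabloEstimate A ϱ ℓ s) t))
        - ∑ t ∈ Finset.range T, inner ℝ (ℓ t) (u t)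
        - ∑ t ∈ Finset.range T, inner ℝ (pabloEstimate A ϱ ℓ s t - ℓ t) (y t) := by
  simp only [pabloRegret, regretNoise, noiseTerm, pabloAction, perturbedAction,
    ← Finset.sum_sub_distrib, ← pabloHistory_eq_lossHistory]
  refine Finset.sum_congr rfl fun t _ => ?_
  simp only [inner_sub_left, inner_sub_right, inner_add_right]
  ring

omit [IsProbabilityMeasure μ] in
theorem exists_norm_action_le (h : IsBanditProcess T G v μ 𝓕 ℓ s) (hd : 1 ≤ d) (hT : 1 ≤ T)
    (hG : 0 < G) (hε : 0 < ε) (hϱ : 0 < ϱ) {t : ℕ} (ht : t < T) :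
    ∃ K : ℝ, ∀ᵐ ω ∂μ, ‖dynamicMetaOLO T (3 * d * G) (ε / d)
      (pabloHistory (dynamicMetaOLO T (3 * d * G) (ε / d)) ϱ
        (fun i => ℓ i ω) (fun i => s i ω) t)‖ ≤ K := by
  have hd0 : (0 : ℝ) < d := by exact_mod_cast hd
  obtain ⟨K, hK⟩ := exists_norm_dynamicMetaOLO_le (d := d) hT
    (by positivity : 0 < 3 * d * G) (by positivity : 0 < ε / d) t
  refine ⟨K, ?_⟩
  filter_upwards [h.ae_bounds] with ω hω
  rw [pabloHistory_eq_lossHistory]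
  refine hK _ fun i hi => ?_
  have h1 := hω i (by omega)
  refine (norm_roundEstimate_le hd hϱ h1.2).trans ?_
  nlinarith [mul_le_mul_of_nonneg_left h1.1 hd0.le]

theorem integral_regretNoise (h : IsBanditProcess T G v μ 𝓕 ℓ s) (hd : 1 ≤ d) (hT : 1 ≤ T)
    (hG : 0 < G) (hε : 0 < ε) (hϱ : 0 < ϱ) {y : ℕ → Ω → EuclideanSpace ℝ (Fin d)}
    (hy : ∀ t < T, Measurable[𝓕 t] (y t)) (hyi : ∀ t < T, Integrable (y t) μ) :
    Integrable (fun ω => regretNoise (dynamicMetaOLO T (3 * d * G) (ε / d)) ϱ T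
        (fun t => ℓ t ω) (fun t => s t ω) (fun t => y t ω)) μ ∧
      ∫ ω, regretNoise (dynamicMetaOLO T (3 * d * G) (ε / d)) ϱ T
        (fun t => ℓ t ω) (fun t => s t ω) (fun t => y t ω) ∂μ = 0 := by
  set A : OLOLearner (EuclideanSpace ℝ (Fin d)) := dynamicMetaOLO T (3 * d * G) (ε / d) with hA
  have key : ∀ t ∈ Finset.range T,
      Integrable (fun ω => noiseTerm A ϱ (fun i => ℓ i ω) (fun i => s i ω) (fun i => y i ω) t) μ ∧
      ∫ ω, noiseTerm A ϱ (fun i => ℓ i ω) (fun i => s i ω) (fun i => y i ω) t ∂μ = 0 := by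
    intro t ht
    have ht := Finset.mem_range.1 ht
    have hw := (h.measurable_estimate_and_action ϱ (3 * d * G) (ε / d) ht.le).2
    obtain ⟨K, hK⟩ := h.exists_norm_action_le hd hT hG hε hϱ ht
    have h1 := h.integral_inner_exploration hd hϱ ht hw hK
    have h2 := h.integral_inner_estimate_sub hd hϱ ht hw hw
      (Integrable.of_bound (hw.mono (𝓕.le t) le_rfl).aestronglyMeasurable K hK)
    have h3 := h.integral_inner_estimate_sub hd hϱ ht hw (hy t ht) (hyi t ht)
    have h4 := (h1.1.sub h2.1).add h3.1
    have h5 := integral_add (h1.1.sub h2.1) h3.1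
    have h6 := integral_sub h1.1 h2.1
    simp only [Pi.sub_apply] at h5
    rw [h6, h1.2, h2.2, h3.2, sub_zero, add_zero] at h5
    exact ⟨h4, h5⟩
  unfold regretNoise
  refine ⟨integrable_finsetSum _ fun t ht => (key t ht).1, ?_⟩
  rw [integral_finsetSum _ fun t ht => (key t ht).1]
  exact Finset.sum_eq_zero fun t ht => (key t ht).2

theorem integrable_pabloRegret (h : IsBanditProcess T G v μ 𝓕 ℓ s) (hd : 1 ≤ d) (hT : 1 ≤ T)
    (hG : 0 < G) (hε : 0 < ε) (hϱ : 0 < ϱ) {u : ℕ → Ω → EuclideanSpace ℝ (Fin d)}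
    (hui : ∀ t < T, Integrable (u t) μ) :
    Integrable (fun ω => pabloRegret (dynamicMetaOLO T (3 * d * G) (ε / d)) ϱ T
      (fun t => ℓ t ω) (fun t => s t ω) (fun t => u t ω)) μ := by
  unfold pabloRegret
  refine integrable_finsetSum _ fun t ht => ?_
  have ht := Finset.mem_range.1 ht
  have hw := (h.measurable_estimate_and_action ϱ (3 * d * G) (ε / d) ht.le).2
  obtain ⟨K, hK⟩ := h.exists_norm_action_le hd hT hG hε hϱ ht
  have h1 := (h.integral_inner_exploration hd hϱ ht hw hK).1
  have hwi := Integrable.of_bound (hw.mono (𝓕.le t) le_rfl).aestronglyMeasurable K hK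
  have hℓ := ((h.measurable_loss t ht).mono (𝓕.le t) le_rfl).aestronglyMeasurable (μ := μ)
  have hinner : ∀ {y : Ω → EuclideanSpace ℝ (Fin d)}, Integrable y μ →
      Integrable (fun ω => (inner ℝ (ℓ t ω) (y ω) : ℝ)) μ := fun {y} hy => by
    refine Integrable.mono' (hy.norm.const_mul G) (hℓ.inner hy.aestronglyMeasurable) ?_
    filter_upwards [h.norm_loss_le t ht] with ω hω
    exact (norm_inner_le_norm _ _).trans (mul_le_mul_of_nonneg_right hω (norm_nonneg _))
  refine (((hinner hwi).add h1).sub (hinner (hui t ht))).congr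
    (Filter.Eventually.of_forall fun ω => ?_)
  simp only [Pi.sub_apply, Pi.add_apply, pabloAction, perturbedAction, inner_sub_right,
    inner_add_right]

/-- Expected regret against comparators that may depend on everything. -/
theorem adaptive_regret_le (h : IsBanditProcess T G v μ 𝓕 ℓ s) (hd : 1 ≤ d) (hT : 1 ≤ T)
    (hG : 0 < G) (hε : 0 < ε) (hϱ : 0 < ϱ) {u : ℕ → Ω → EuclideanSpace ℝ (Fin d)}
    (hu : ∀ t < T, Measurable (u t))
    (hB : Integrable (fun ω =>
      dynamicBound 1 T G ε (fun t => ‖ℓ t ω‖ ^ 2) fun t => u t ω) μ) :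
    Integrable (fun ω => pabloRegret (dynamicMetaOLO T (3 * d * G) (ε / d)) ϱ T
      (fun t => ℓ t ω) (fun t => s t ω) (fun t => u t ω)) μ ∧
    ∫ ω, pabloRegret (dynamicMetaOLO T (3 * d * G) (ε / d)) ϱ T
      (fun t => ℓ t ω) (fun t => s t ω) (fun t => u t ω) ∂μ ≤
      1000 * ∫ ω, dynamicBound 1 T G ε (fun t => ‖ℓ t ω‖ ^ 2) (fun t => u t ω) ∂μ := by
  have hd0 : (1 : ℝ) ≤ d := by exact_mod_cast hd
  obtain ⟨-, -, hui⟩ := integrable_comparator (q := fun t ω => ‖ℓ t ω‖ ^ 2) hd hT zero_le_one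
    hG hε hu hB
  set A : OLOLearner (EuclideanSpace ℝ (Fin d)) := dynamicMetaOLO T (3 * d * G) (ε / d) with hA
  have hR := h.integrable_pabloRegret hd hT hG hε hϱ hui
  refine ⟨hR, ?_⟩
  set e : ℕ → Ω → EuclideanSpace ℝ (Fin d) := fun t ω =>
    pabloEstimate A ϱ (fun i => ℓ i ω) (fun i => s i ω) t with he
  -- the decisions of a second learner, which is run on the estimation errors
  set y : ℕ → Ω → EuclideanSpace ℝ (Fin d) := fun t ω =>
    A (lossHistory (fun i => ℓ i ω - e i ω) t) with hy
  have hbound : ∀ᵐ ω ∂μ, ∀ t < T, ‖ℓ t ω‖ ≤ G ∧ ‖e t ω‖ ≤ 3 * d * ‖ℓ t ω‖ ∧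
      ‖ℓ t ω - e t ω‖ ≤ 3 * d * ‖ℓ t ω‖ := by
    filter_upwards [h.ae_bounds] with ω hω t ht
    refine ⟨(hω t ht).1, ?_, norm_sub_roundEstimate_le hd hϱ (hω t ht).2⟩
    refine (norm_roundEstimate_le hd hϱ (hω t ht).2).trans ?_
    gcongr
    norm_num
  have hym : ∀ t < T, Measurable[𝓕 t] (y t) := fun t ht =>
    @measurable_dynamicMetaOLO d Ω (𝓕 t) T (3 * d * G) (ε / d) (fun i ω => ℓ i ω - e i ω) t
      fun i hi => @measurable_vector_sub d Ω (𝓕 t) _ _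
        ((h.measurable_loss i (by omega)).mono (𝓕.mono hi.le) le_rfl)
        (((h.measurable_estimate_and_action ϱ (3 * d * G) (ε / d) ht.le).1 i hi).mono
          (𝓕.mono hi) le_rfl)
  have hyi : ∀ t < T, Integrable (y t) μ := fun t ht => by
    obtain ⟨K, hK⟩ := exists_norm_dynamicMetaOLO_le (d := d) hT
      (by positivity : 0 < 3 * d * G) (by positivity : 0 < ε / d) t
    refine Integrable.of_bound ((hym t ht).mono (𝓕.le t) le_rfl).aestronglyMeasurable K ?_
    filter_upwards [hbound] with ω hω
    refine hK _ fun i hi => ?_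
    have h1 := hω i (by omega)
    exact h1.2.2.trans (mul_le_mul_of_nonneg_left h1.1 (by positivity))
  obtain ⟨hZ, hZ0⟩ := h.integral_regretNoise hd hT hG hε hϱ hym hyi
  have hle : (fun ω => pabloRegret A ϱ T (fun t => ℓ t ω) (fun t => s t ω) (fun t => u t ω))
      ≤ᵐ[μ] fun ω => regretNoise A ϱ T (fun t => ℓ t ω) (fun t => s t ω) (fun t => y t ω)
        + 1000 * dynamicBound 1 T G ε (fun t => ‖ℓ t ω‖ ^ 2) (fun t => u t ω) := by
    filter_upwards [hbound] with ω hω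
    have h1 := pabloRegret_sub_regretNoise A ϱ T (fun t => ℓ t ω) (fun t => s t ω)
      (fun t => u t ω) (fun t => y t ω)
    have h2 := adaptive_pathwise_le hd hT hG hε (ℓ := fun t => ℓ t ω) (e := fun t => e t ω)
      (fun t ht => (hω t ht).1) (fun t ht => (hω t ht).2.1) (fun t ht => (hω t ht).2.2)
      (fun t => u t ω)
    have h3 : ∑ t ∈ Finset.range T, inner ℝ (e t ω - ℓ t ω) (y t ω) =
        -∑ t ∈ Finset.range T, inner ℝ (ℓ t ω - e t ω) (y t ω) := by
      rw [← Finset.sum_neg_distrib]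
      refine Finset.sum_congr rfl fun t _ => ?_
      rw [← inner_neg_left, neg_sub]
    linarith
  refine (integral_mono_ae hR (hZ.add (hB.const_mul 1000)) hle).trans ?_
  have h4 := integral_add hZ (hB.const_mul 1000)
  rw [hZ0, integral_const_mul, zero_add] at h4
  exact h4.le

/-- Expected regret against comparators that are fixed at the start. The sequence `q` stands for
the squared norms of the losses or for their conditional expectations at the start: only its
integrals against quantities known at the start matter. -/
theorem oblivious_regret_le (h : IsBanditProcess T G v μ 𝓕 ℓ s) (hd : 1 ≤ d) (hT : 1 ≤ T)
    (hG : 0 < G) (hε : 0 < ε) (hϱ : 0 < ϱ) {u : ℕ → Ω → EuclideanSpace ℝ (Fin d)}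
    (hu : ∀ t < T, Measurable[𝓕 0] (u t)) {q : ℕ → Ω → ℝ}
    (hq : ∀ t < T, Measurable[𝓕 0] (q t))
    (hqG : ∀ᵐ ω ∂μ, ∀ t < T, 0 ≤ q t ω ∧ q t ω ≤ G ^ 2)
    (hqi : ∀ t < T, ∀ c : Ω → ℝ, Measurable[𝓕 0] c → Integrable c μ →
      ∫ ω, c ω * ‖ℓ t ω‖ ^ 2 ∂μ = ∫ ω, c ω * q t ω ∂μ)
    (hB : Integrable (fun ω =>
      dynamicBound √(d : ℝ) T G ε (fun t => q t ω) fun t => u t ω) μ) :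
    Integrable (fun ω => pabloRegret (dynamicMetaOLO T (3 * d * G) (ε / d)) ϱ T
      (fun t => ℓ t ω) (fun t => s t ω) (fun t => u t ω)) μ ∧
    ∫ ω, pabloRegret (dynamicMetaOLO T (3 * d * G) (ε / d)) ϱ T
      (fun t => ℓ t ω) (fun t => s t ω) (fun t => u t ω) ∂μ ≤
      1000 * ∫ ω, dynamicBound √(d : ℝ) T G ε (fun t => q t ω) (fun t => u t ω) ∂μ := by
  have hd0 : (1 : ℝ) ≤ d := by exact_mod_cast hd
  have hT0 : (1 : ℝ) ≤ T := by exact_mod_cast hT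
  have hum : ∀ t < T, Measurable (u t) := fun t ht => (hu t ht).mono (𝓕.le 0) le_rfl
  obtain ⟨hMi, hQi, hui⟩ := integrable_comparator hd hT (Real.sqrt_nonneg d) hG hε hum hB
  set A : OLOLearner (EuclideanSpace ℝ (Fin d)) := dynamicMetaOLO T (3 * d * G) (ε / d) with hA
  have hR := h.integrable_pabloRegret hd hT hG hε hϱ hui
  refine ⟨hR, ?_⟩
  set e : ℕ → Ω → EuclideanSpace ℝ (Fin d) := fun t ω =>
    pabloEstimate A ϱ (fun i => ℓ i ω) (fun i => s i ω) t with he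
  set y : ℕ → Ω → EuclideanSpace ℝ (Fin d) := fun t ω =>
    truncatedComparator T ε (fun i => u i ω) t with hy
  have hym : ∀ t < T, Measurable[𝓕 0] (y t) := fun t ht =>
    @measurable_truncatedComparator d T Ω (𝓕 0) ε u hu t ht
  have hyi : ∀ t < T, Integrable (y t) μ := fun t ht =>
    Integrable.mono (hui t ht) ((hym t ht).mono (𝓕.le 0) le_rfl).aestronglyMeasurable
      (Filter.Eventually.of_forall fun ω => norm_truncatedComparator_le T ε _ t)
  obtain ⟨hZ, hZ0⟩ := h.integral_regretNoise hd hT hG hε hϱ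
    (fun t ht => (hym t ht).mono (𝓕.mono (Nat.zero_le t)) le_rfl) hyi
  set M : Ω → ℝ := fun ω => maxNorm T fun t => u t ω with hM
  set Q : Ω → ℝ := fun ω => pathCost T ε fun t => u t ω with hQ
  set X : Ω → ℝ := fun ω => ∑ t ∈ Finset.range T, q t ω * ‖u t ω‖ with hX
  set a : Ω → ℝ := fun ω => Q ω + ε / T with ha
  -- the summand with `M` makes `b` vanish only where all comparators do
  set b : Ω → ℝ := fun ω => d * (X ω + G ^ 2 * M ω) with hb
  set c : ℕ → Ω → ℝ := fun t ω => √(a ω / b ω) * ‖u t ω‖ with hc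
  set B : Ω → ℝ := fun ω => dynamicBound √(d : ℝ) T G ε (fun t => q t ω) fun t => u t ω with hBdef
  have hM0 : ∀ ω, 0 ≤ M ω := fun ω => maxNorm_nonneg T _
  have hQ0 : ∀ ω, 0 ≤ Q ω := fun ω => pathCost_nonneg hT hε _
  have ha0 : ∀ ω, 0 ≤ a ω := fun ω => add_nonneg (hQ0 ω) (by positivity)
  have hmeas : Measurable[𝓕 0] a ∧ Measurable[𝓕 0] b := by
    have h1 : Measurable[𝓕 0] M := @measurable_maxNorm d Ω (𝓕 0) T u hu
    have h2 : Measurable[𝓕 0] Q := @measurable_pathCost d Ω (𝓕 0) T hT ε u hu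
    have h3 : Measurable[𝓕 0] X := @measurable_sum_mul_norm d T Ω (𝓕 0) q u hq hu
    exact ⟨h2.add_const _, (h3.add (h1.const_mul _)).const_mul _⟩
  have hX0 : ∀ᵐ ω ∂μ, 0 ≤ X ω ∧ X ω ≤ G ^ 2 * T * M ω := by
    filter_upwards [hqG] with ω hω
    exact ⟨Finset.sum_nonneg fun t ht =>
      mul_nonneg (hω t (Finset.mem_range.1 ht)).1 (norm_nonneg _), sum_mul_norm_le hω _⟩
  have hcm : ∀ t < T, Measurable[𝓕 0] (c t) := fun t ht =>
    @measurable_sqrt_div_mul_norm d Ω (𝓕 0) a b (u t) hmeas.1 hmeas.2 (hu t ht)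
  have hai : Integrable a μ := hQi.add (integrable_const _)
  have hci : ∀ t < T, Integrable (c t) μ := fun t ht => by
    refine Integrable.mono' ((hai.add hMi).div_const G)
      ((hcm t ht).mono (𝓕.le 0) le_rfl).aestronglyMeasurable ?_
    filter_upwards [hX0] with ω hω
    rw [Real.norm_of_nonneg (by positivity)]
    refine sqrt_div_mul_le (ha0 ω) hG (norm_nonneg _) (norm_le_maxNorm ht fun i => u i ω) ?_
    have := mul_nonneg (sq_nonneg G) (hM0 ω)
    simp only [hb]
    nlinarith [hω.1]
  have hB1 : ∀ ω, d * G * (ε + M ω + Q ω) ≤ B ω := fun ω =>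
    mul_add_le_dynamicBound (Real.sqrt_nonneg d) _ _
  have hab : ∀ᵐ ω ∂μ, √(a ω * b ω) ≤ 2 * B ω := by
    filter_upwards [hX0] with ω hω
    have hXM := mul_nonneg (sq_nonneg G) (hM0 ω)
    have h1 : √(a ω * (X ω + G ^ 2 * M ω)) ≤
        √(Q ω * X ω) + G * (2 * ε + 2 * M ω + Q ω) := by
      have h2 : √(a ω * (X ω + G ^ 2 * M ω)) ≤ √(a ω * X ω) + √(a ω * (G ^ 2 * M ω)) := by
        rw [mul_add]
        exact sqrt_add_le_add_sqrt (mul_nonneg (ha0 ω) hω.1) (mul_nonneg (ha0 ω) hXM)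
      have h3 := sqrt_add_mul_le hT hG hε (hQ0 ω) (hM0 ω) hω.1 hω.2
      have h4 : √(a ω * (G ^ 2 * M ω)) ≤ G * (a ω + M ω) := by
        rw [Real.sqrt_le_left (mul_nonneg hG.le (add_nonneg (ha0 ω) (hM0 ω))), mul_pow]
        have := mul_nonneg (sq_nonneg G) (mul_nonneg (ha0 ω) (hM0 ω))
        have := mul_nonneg (sq_nonneg G) (sq_nonneg (a ω))
        have := mul_nonneg (sq_nonneg G) (sq_nonneg (M ω))
        nlinarith
      have h5 : a ω ≤ Q ω + ε := by
        have : ε / T ≤ ε := div_le_self hε.le hT0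
        simp only [ha]
        linarith
      have h6 := mul_le_mul_of_nonneg_left h5 hG.le
      have h3' : √(a ω * X ω) ≤ √(Q ω * X ω) + G * (ε + M ω) := h3
      nlinarith
    have e1 : √(a ω * b ω) = √d * √(a ω * (X ω + G ^ 2 * M ω)) := by
      rw [← Real.sqrt_mul (by positivity)]
      congr 1
      simp only [hb]
      ring
    have e2 : B ω = √d * √(Q ω * X ω) + d * G * (ε + M ω + Q ω) := by
      simp only [hBdef, dynamicBound_eq, Real.div_sqrt]
      rfl
    have h7 : √(d : ℝ) ≤ d := by
      rw [Real.sqrt_le_left (by positivity)]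
      nlinarith
    have h8 := mul_le_mul_of_nonneg_left h1 (Real.sqrt_nonneg (d : ℝ))
    have h9 : √(d : ℝ) * (G * (2 * ε + 2 * M ω + Q ω)) ≤ d * (G * (2 * ε + 2 * M ω + Q ω)) :=
      mul_le_mul_of_nonneg_right h7 (mul_nonneg hG.le (by linarith [hM0 ω, hQ0 ω]))
    have h10 : 0 ≤ √(d : ℝ) * √(Q ω * X ω) := by positivity
    have h11 := mul_nonneg (mul_nonneg (by linarith : (0 : ℝ) ≤ d) hG.le) (hQ0 ω)
    rw [e1, e2]
    nlinarith
  have habi : Integrable (fun ω => √(a ω * b ω)) μ := by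
    refine Integrable.mono' (hB.const_mul 2)
      (((hmeas.1.mul hmeas.2).sqrt).mono (𝓕.le 0) le_rfl).aestronglyMeasurable ?_
    filter_upwards [hab] with ω hω
    rwa [Real.norm_of_nonneg (Real.sqrt_nonneg _)]
  have hestimate : ∀ t < T, Integrable (fun ω => c t ω * ‖e t ω‖ ^ 2) μ ∧
      ∫ ω, c t ω * ‖e t ω‖ ^ 2 ∂μ ≤ 2 * d * ∫ ω, c t ω * q t ω ∂μ := fun t ht => by
    have h1 := h.integral_mul_norm_sq_estimate_le hd hϱ ht
      (h.measurable_estimate_and_action ϱ (3 * d * G) (ε / d) ht.le).2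
      ((hcm t ht).mono (𝓕.mono (Nat.zero_le t)) le_rfl) (fun ω => by positivity) (hci t ht)
    rw [hqi t ht (c t) (hcm t ht) (hci t ht)] at h1
    exact h1
  have hcq : ∀ t ∈ Finset.range T, Integrable (fun ω => c t ω * q t ω) μ := fun t ht => by
    have ht := Finset.mem_range.1 ht
    refine Integrable.mono' ((hci t ht).mul_const (G ^ 2))
      (((hcm t ht).mul (hq t ht)).mono (𝓕.le 0) le_rfl).aestronglyMeasurable ?_
    filter_upwards [hqG] with ω hω
    have hc0 : 0 ≤ c t ω := by positivity
    rw [Real.norm_of_nonneg (mul_nonneg hc0 (hω t ht).1)]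
    exact mul_le_mul_of_nonneg_left (hω t ht).2 hc0
  have hsumq : ∑ t ∈ Finset.range T, ∫ ω, c t ω * ‖e t ω‖ ^ 2 ∂μ ≤
      2 * ∫ ω, √(a ω * b ω) ∂μ := by
    calc _ ≤ ∑ t ∈ Finset.range T, 2 * d * ∫ ω, c t ω * q t ω ∂μ :=
          Finset.sum_le_sum fun t ht => (hestimate t (Finset.mem_range.1 ht)).2
      _ = ∫ ω, 2 * d * ∑ t ∈ Finset.range T, c t ω * q t ω ∂μ := by
          rw [← Finset.mul_sum, integral_const_mul, integral_finsetSum _ hcq]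
      _ ≤ ∫ ω, 2 * √(a ω * b ω) ∂μ := by
          refine integral_mono_ae ((integrable_finsetSum _ hcq).const_mul _)
            (habi.const_mul 2) ?_
          filter_upwards [hX0] with ω hω
          have hXM := mul_nonneg (sq_nonneg G) (hM0 ω)
          have hb0 : 0 ≤ b ω := mul_nonneg (by linarith) (add_nonneg hω.1 hXM)
          have e1 : ∑ t ∈ Finset.range T, c t ω * q t ω = √(a ω / b ω) * X ω := by
            simp only [hX, hc, Finset.mul_sum]
            exact Finset.sum_congr rfl fun t _ => by ring
          have h1 : d * X ω ≤ b ω := by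
            simp only [hb]
            nlinarith
          have h2 := mul_le_mul_of_nonneg_left h1 (Real.sqrt_nonneg (a ω / b ω))
          rw [sqrt_div_mul_self_eq hb0] at h2
          simp only [e1]
          linarith
      _ = _ := integral_const_mul _ _
  have hle : (fun ω => pabloRegret A ϱ T (fun t => ℓ t ω) (fun t => s t ω) (fun t => u t ω))
      ≤ᵐ[μ] fun ω => regretNoise A ϱ T (fun t => ℓ t ω) (fun t => s t ω) (fun t => y t ω)
        + (10 * ∑ t ∈ Finset.range T, c t ω * ‖e t ω‖ ^ 2 + 420 * B ω) := by
    filter_upwards [h.ae_bounds, hX0, hab] with ω hω hXω habω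
    have hest : ∀ t < T, ‖e t ω‖ ≤ 3 * d * ‖ℓ t ω‖ := fun t ht => by
      refine (norm_roundEstimate_le hd hϱ (hω t ht).2).trans ?_
      gcongr
      norm_num
    have h1 := pabloRegret_sub_regretNoise A ϱ T (fun t => ℓ t ω) (fun t => s t ω)
      (fun t => u t ω) (fun t => y t ω)
    have h2 := oblivious_pathwise_le hd hT hG hε (ℓ := fun t => ℓ t ω) (e := fun t => e t ω)
      (fun t ht => (hω t ht).1) hest (fun t => u t ω) (fun t => y t ω)
      (fun hn => by simp only [hy, truncatedComparator, if_pos hn])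
      (fun hn => by simp only [hy, truncatedComparator, if_neg hn])
    have hXM := mul_nonneg (sq_nonneg G) (hM0 ω)
    have hS0 : 0 ≤ ∑ t ∈ Finset.range T, ‖e t ω‖ ^ 2 * ‖u t ω‖ :=
      Finset.sum_nonneg fun t _ => by positivity
    have h3 := sqrt_mul_le_half_add (ha0 ω)
      (mul_nonneg (by linarith) (add_nonneg hXω.1 hXM) : 0 ≤ b ω) hS0 fun hb0 => by
        have hMω : M ω = 0 := by
          have h4 : X ω + G ^ 2 * M ω = 0 :=
            (mul_eq_zero.1 hb0).resolve_left (by positivity)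
          have h5 : G ^ 2 * M ω = 0 := by linarith [hXω.1]
          exact (mul_eq_zero.1 h5).resolve_left (by positivity)
        refine Finset.sum_eq_zero fun t ht => ?_
        have : ‖u t ω‖ ≤ M ω := norm_le_maxNorm (Finset.mem_range.1 ht) fun i => u i ω
        rw [le_antisymm (this.trans hMω.le) (norm_nonneg _), mul_zero]
    have e1 : √(a ω / b ω) * ∑ t ∈ Finset.range T, ‖e t ω‖ ^ 2 * ‖u t ω‖ =
        ∑ t ∈ Finset.range T, c t ω * ‖e t ω‖ ^ 2 := by
      simp only [hc, Finset.mul_sum]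
      exact Finset.sum_congr rfl fun t _ => by ring
    rw [e1] at h3
    have h4 := hB1 ω
    have h1' : pabloRegret A ϱ T (fun t => ℓ t ω) (fun t => s t ω) (fun t => u t ω)
        - regretNoise A ϱ T (fun t => ℓ t ω) (fun t => s t ω) (fun t => y t ω) ≤
        20 * √(a ω * ∑ t ∈ Finset.range T, ‖e t ω‖ ^ 2 * ‖u t ω‖)
          + 400 * (d * G * (ε + M ω + Q ω)) := h1.le.trans h2
    linarith
  have hsumi : Integrable (fun ω => ∑ t ∈ Finset.range T, c t ω * ‖e t ω‖ ^ 2) μ :=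
    integrable_finsetSum _ fun t ht => (hestimate t (Finset.mem_range.1 ht)).1
  have hrest := (hsumi.const_mul 10).add (hB.const_mul 420)
  refine (integral_mono_ae hR (hZ.add hrest) hle).trans ?_
  have h4 := integral_add hZ hrest
  have h5 := integral_add (hsumi.const_mul 10) (hB.const_mul 420)
  rw [integral_const_mul, integral_const_mul,
    integral_finsetSum _ fun t ht => (hestimate t (Finset.mem_range.1 ht)).1] at h5
  have h6 : ∫ ω, √(a ω * b ω) ∂μ ≤ 2 * ∫ ω, B ω ∂μ := by
    rw [← integral_const_mul]
    exact integral_mono_ae habi (hB.const_mul 2) hab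
  have h7 : 0 ≤ ∫ ω, B ω ∂μ := integral_nonneg fun ω => le_trans (by
    have := hM0 ω
    have := hQ0 ω
    positivity) (hB1 ω)
  simp only [Pi.add_apply] at h4 h5 ⊢
  rw [h4, hZ0, h5]
  linarith

end IsBanditProcess

theorem mainTheorem2 :
    ∃ C : ℝ, 0 < C ∧
      ∀ (d T : ℕ) (_ : 1 ≤ d) (_ : 1 ≤ T) (G ε ϱ : ℝ) (_ : 0 < G) (_ : 0 < ε) (_ : 0 < ϱ)
        -- the eigenbases used for sampling
        (v : ℕ → OrthonormalBasis (Fin d) ℝ (EuclideanSpace ℝ (Fin d)))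
        -- `𝓕 t` is the history up to the start of round `t` (rounds `0, …, T - 1`)
        (Ω : Type*) (mΩ : MeasurableSpace Ω) (μ : Measure Ω) (_ : IsProbabilityMeasure μ)
        (𝓕 : Filtration ℕ mΩ)
        (ℓ s u : ℕ → Ω → EuclideanSpace ℝ (Fin d))
        -- the loss of round `t` is chosen from the history and is bounded by `G`
        (_ : ∀ t < T, Measurable[𝓕 t] (ℓ t))
        (_ : ∀ t < T, ∀ᵐ ω ∂μ, ‖ℓ t ω‖ ≤ G)
        -- the direction of round `t` is uniform on `{± v_i}` and independent of the history
        (_ : ∀ t < T, Measurable[𝓕 (t + 1)] (s t))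
        (_ : ∀ t < T, μ.map (s t) = uniformOn (signedBasis (v t)))
        (_ : ∀ t < T, Indep (MeasurableSpace.comap (s t) inferInstance) (𝓕 t) μ)
        -- the comparators are arbitrary random vectors
        (_ : ∀ t < T, Measurable (u t)),
        let R : Ω → ℝ := fun ω =>
          pabloRegret (dynamicMetaOLO T (3 * d * G) (ε / d)) ϱ T
            (fun t => ℓ t ω) (fun t => s t ω) (fun t => u t ω)
        -- `R` has expected value at most `C` times that of `B`, whenever the latter is finite
        let BoundedBy : (Ω → ℝ) → Prop := fun B =>
          Integrable B μ → Integrable R μ ∧ ∫ ω, R ω ∂μ ≤ C * ∫ ω, B ω ∂μ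
        -- adaptive losses and comparators
        BoundedBy (fun ω =>
          dynamicBound 1 T G ε (fun t => ‖ℓ t ω‖ ^ 2) (fun t => u t ω)) ∧
        -- comparators fixed at the start, adaptive losses
        ((∀ t < T, Measurable[𝓕 0] (u t)) →
          BoundedBy (fun ω =>
            dynamicBound √(d : ℝ) T G ε (fun t => (μ[fun ω' => ‖ℓ t ω'‖ ^ 2 | 𝓕 0]) ω)
              (fun t => u t ω))) ∧
        -- losses and comparators fixed at the start
        ((∀ t < T, Measurable[𝓕 0] (u t)) → (∀ t < T, Measurable[𝓕 0] (ℓ t)) →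
          BoundedBy (fun ω =>
            dynamicBound √(d : ℝ) T G ε (fun t => ‖ℓ t ω‖ ^ 2) (fun t => u t ω))) := by
  refine ⟨1000, by norm_num, ?_⟩
  intro d T hd hT G ε ϱ hG hε hϱ v Ω mΩ μ hμ 𝓕 ℓ s u hℓ hℓG hs hlaw hind hu
  have h : IsBanditProcess T G v μ 𝓕 ℓ s := ⟨hℓ, hℓG, hs, hlaw, hind⟩
  have hsqm : ∀ t < T, Measurable[𝓕 t] fun ω => ‖ℓ t ω‖ ^ 2 := fun t ht =>
    @measurable_norm_sq d Ω (𝓕 t) _ (hℓ t ht)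
  have hsqG : ∀ t < T, ∀ᵐ ω ∂μ, ‖ℓ t ω‖ ^ 2 ≤ G ^ 2 := fun t ht =>
    (hℓG t ht).mono fun ω hω => pow_le_pow_left₀ (norm_nonneg _) hω 2
  have hsqi : ∀ t < T, Integrable (fun ω => ‖ℓ t ω‖ ^ 2) μ := fun t ht =>
    Integrable.of_bound ((hsqm t ht).mono (𝓕.le t) le_rfl).aestronglyMeasurable (G ^ 2)
      ((hsqG t ht).mono fun ω hω => by rwa [Real.norm_of_nonneg (by positivity)])
  refine ⟨fun hB => h.adaptive_regret_le hd hT hG hε hϱ hu hB, fun hu0 hB => ?_,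
    fun hu0 hℓ0 hB => ?_⟩
  · refine h.oblivious_regret_le hd hT hG hε hϱ hu0
      (fun t _ => stronglyMeasurable_condExp.measurable) ?_ ?_ hB
    · refine ae_all_iff.2 fun t => ?_
      by_cases ht : t < T
      · filter_upwards [condExp_nonneg (m := 𝓕 0) (μ := μ)
          (Filter.Eventually.of_forall fun ω => sq_nonneg ‖ℓ t ω‖),
          condExp_mono (m := 𝓕 0) (hsqi t ht) (integrable_const (G ^ 2)) (hsqG t ht)]
          with ω h1 h2 _
        rw [condExp_const (𝓕.le 0)] at h2
        exact ⟨h1, h2⟩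
      · exact Filter.Eventually.of_forall fun ω h => absurd h ht
    · intro t ht c hc hci
      have hprod : Integrable (c * fun ω => ‖ℓ t ω‖ ^ 2) μ :=
        hci.mul_bdd (c := G ^ 2) (hsqi t ht).aestronglyMeasurable
          ((hsqG t ht).mono fun ω hω => by rwa [Real.norm_of_nonneg (by positivity)])
      have h1 := condExp_mul_of_stronglyMeasurable_left (m := 𝓕 0) hc.stronglyMeasurable hprod
        (hsqi t ht)
      have h2 := integral_condExp (μ := μ) (f := c * fun ω => ‖ℓ t ω‖ ^ 2) (𝓕.le 0)
      rw [integral_congr_ae h1] at h2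
      exact h2.symm
  · refine h.oblivious_regret_le hd hT hG hε hϱ hu0
      (fun t ht => @measurable_norm_sq d Ω (𝓕 0) _ (hℓ0 t ht)) ?_ (fun _ _ _ _ _ => rfl) hB
    filter_upwards [h.ae_bounds] with ω hω t ht
    exact ⟨by positivity, pow_le_pow_left₀ (norm_nonneg _) (hω t ht).1 2⟩
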